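/- **Setting.** Let $n\ge 1$, let $|\psi\rangle$ be an $n$-qubit pure state, and let $0<\varepsilon\le\tau<1$, $1/2<p<1$, $0<\delta<1$. Let $\mathcal P_n=\{I,X,Y,Z\}^{\otimes n}$, $\mathcal{SP}=\{|0\rangle,|1\rangle,|+\rangle,|-\rangle,|i\rangle,|-i\rangle\}^{\otimes n}$ (the stabilizer product states) and $\mathcal F_{\mathcal{SP}}(|\psi\rangle)=\max_{|\varphi\rangle\in\mathcal{SP}}|\langle\varphi|\psi\rangle|^2$. Put $p_\psi(P)=2^{-n}\langle\psi|P|\psi\rangle^2$ and $q_\psi(P)=\sum_{Q\in\mathcal P_n}p_\psi(Q)\,p_\psi(PQ)$ for $P\in\mathcal P_n$, where $PQ$ is taken modulo phase. *Bell difference sampling* uses four copies of $|\psi\rangle$ and returns $P\in\mathcal P_n$ with probability $q_\psi(P)$. Two Pauli strings *commute locally* if they commute on every single qubit. The *local span* of a set of pairwise locally commuting Pauli strings is $\{I,W_1\}\otimes\cdots\otimes\{I,W_n\}$, where $W_i$ is the only non-identity Pauli that occurs on qubit $i$ in the set, or $W_i=I$ if there is none. A *stabilizer product group* is $\overline S=\{I,W_1\}\otimes\cdots\otimes\{I,W_n\}$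 with all $W_i\in\{X,Y,Z\}$; the *$\overline S$-basis* consists of the $2^n$ stabilizer product states whose $i$-th factor is an eigenstate of $W_i$ for every $i$. **Algorithm (Stabilizer Product State Approximation).** With $\mathsf H(p)=-p\log_2p-(1-p)\log_2(1-p)$, set $m_{\mathrm{outer}}=\lceil\log_{3/4}(\delta/2)\rceil$, $k=\lceil\log_p(1/(2n))\rceil$, $m_{\mathrm{clique}}=\lceil(k+1)/\tau^4\rceil$, $t=\dfrac{4\log_2(1/\tau)}{1-\mathsf H(p)}$ and $m_{\mathrm{est}}=\Big\lceil \dfrac{8}{\varepsilon^{2}}\ln\!\Big(4\,m_{\mathrm{outer}}\tbinom{m_{\mathrm{clique}}}{k}3^t/\delta\Big)\Big\rceil$. Repeat the following $m_{\mathrm{outer}}$ times. Take $m_{\mathrm{clique}}$ Bell difference samples of $|\psi\rangle$ and form the graph that has one vertex per sample, two distinct vertices being adjacent when the samples commute locally. For every clique of size $k$, let $S$ be the local span of its samples; if $\log_2|S|\ge n-t$, then for every stabilizer product group $\overline S\supseteq S$ measure $m_{\mathrm{est}}$ fresh copies of $|\psi\rangle$ in the $\overline S$-basis and record each $|\phi\rangle$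 of that basis together with the fraction $\hat o_\phi$ of the measurements that gave $|\phi\rangle$. At the end return a recorded state with the largest recorded $\hat o_\phi$, or $|0\rangle^{\otimes n}$ if nothing was recorded. **Theorem.** The algorithm outputs a stabilizer product state $|\phi\rangle$, and 1. if $\mathcal F_{\mathcal{SP}}(|\psi\rangle)\ge\tau$, then with probability at least $1-\delta$, $$|\langle\phi|\psi\rangle|^2\ \ge\ \mathcal F_{\mathcal{SP}}(|\psi\rangle)-\varepsilon ;$$ 2. if the algorithm is run with $\tau=\varepsilon$, then the same holds with probability at least $1-\delta$ for every pure state $|\psi\rangle$, without any assumption on $\mathcal F_{\mathcal{SP}}(|\psi\rangle)$. In particular, this is proper agnostic tomography, on pure state inputs, for the class $\{|0\rangle,|1\rangle,|+\rangle,|-\rangle,|i\rangle,|-i\rangle\}^{\otimes n}$. -/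

import Mathlib

namespace StabProdTomography

/-! ### Pauli strings -/

/-- The four single-qubit Pauli operators (as labels). -/
inductive Pauli1 where
  | I | X | Y | Z
  deriving DecidableEq

instance : Fintype Pauli1 :=
  ⟨{.I, .X, .Y, .Z}, fun a => by cases a <;> decide⟩

namespace Pauli1

/-- The matrix of a single-qubit Pauli operator. -/
noncomputable def mat : Pauli1 → Matrix (Fin 2) (Fin 2) ℂ
  | I => !![1, 0; 0, 1]
  | X => !![0, 1; 1, 0]
  | Y => !![0, -Complex.I; Complex.I, 0]
  | Z => !![1, 0; 0, -1]

/-- Multiplication of single-qubit Pauli operators, modulo global phase. -/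
def mul : Pauli1 → Pauli1 → Pauli1
  | I, Q => Q
  | P, I => P
  | X, X => I
  | Y, Y => I
  | Z, Z => I
  | X, Y => Z
  | Y, X => Z
  | X, Z => Y
  | Z, X => Y
  | Y, Z => X
  | Z, Y => X

end Pauli1

/-- The set `{I, X, Y, Z}^{⊗ n}` of `n`-qubit Pauli operators: the string `P` stands for
`P 0 ⊗ ⋯ ⊗ P (n - 1)`. -/
abbrev Pauli (n : ℕ) : Type := Fin n → Pauli1

/-- The `2^n × 2^n` matrix of a Pauli string; rows and columns are indexed by bit strings. -/
noncomputable def Pauli.mat {n : ℕ} (P : Pauli n) :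
    Matrix (Fin n → Fin 2) (Fin n → Fin 2) ℂ :=
  fun x y => ∏ i, (P i).mat (x i) (y i)

/-- Multiplication of Pauli strings, modulo global phase. -/
def Pauli.mul {n : ℕ} (P Q : Pauli n) : Pauli n := fun i => (P i).mul (Q i)

open Classical in
/-- `[[P, Q]]`: the number of qubits on which `P` and `Q` fail to commute. -/
noncomputable def localNoncomm {n : ℕ} (P Q : Pauli n) : ℕ :=
  (Finset.univ.filter fun i : Fin n =>
    (P i).mat * (Q i).mat ≠ (Q i).mat * (P i).mat).card

/-! ### States -/

/-- An `n`-qubit pure state: a unit vector of `(ℂ²)^{⊗ n}`, with the computational basis indexed by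
bit strings. -/
structure PureState (n : ℕ) where
  vec : EuclideanSpace ℂ (Fin n → Fin 2)
  norm_eq_one : ‖vec‖ = 1

/-- The six single-qubit stabilizer states `|0⟩, |1⟩, |+⟩, |-⟩, |i⟩, |-i⟩` (as labels). -/
inductive Stab1 where
  | zero | one | plus | minus | plusI | minusI
  deriving DecidableEq

instance : Fintype Stab1 :=
  ⟨{.zero, .one, .plus, .minus, .plusI, .minusI}, fun a => by cases a <;> decide⟩

/-- The amplitudes of a single-qubit stabilizer state. -/
noncomputable def Stab1.amp : Stab1 → Fin 2 → ℂ
  | zero => ![1, 0]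
  | one => ![0, 1]
  | plus => ![1 / (Real.sqrt 2 : ℂ), 1 / (Real.sqrt 2 : ℂ)]
  | minus => ![1 / (Real.sqrt 2 : ℂ), -1 / (Real.sqrt 2 : ℂ)]
  | plusI => ![1 / (Real.sqrt 2 : ℂ), Complex.I / (Real.sqrt 2 : ℂ)]
  | minusI => ![1 / (Real.sqrt 2 : ℂ), -Complex.I / (Real.sqrt 2 : ℂ)]

/-- (Classical descriptions of) the stabilizer product states
`{|0⟩, |1⟩, |+⟩, |-⟩, |i⟩, |-i⟩}^{⊗ n}`. -/
abbrev StabProd (n : ℕ) : Type := Fin n → Stab1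

/-- The state vector of a stabilizer product state. -/
noncomputable def StabProd.vec {n : ℕ} (φ : StabProd n) : EuclideanSpace ℂ (Fin n → Fin 2) :=
  WithLp.toLp 2 fun x => ∏ i, (φ i).amp (x i)

/-- The fidelity `|⟨φ|ψ⟩|²`. -/
noncomputable def fidelity {n : ℕ} (φ : StabProd n) (ψ : PureState n) : ℝ :=
  ‖inner ℂ φ.vec ψ.vec‖ ^ 2

/-- The stabilizer product fidelity: the maximum of `|⟨φ|ψ⟩|²` over stabilizer product states. -/
noncomputable def stabProdFidelity {n : ℕ} (ψ : PureState n) : ℝ :=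
  Finset.univ.sup' ⟨fun _ => Stab1.zero, Finset.mem_univ _⟩ fun φ : StabProd n => fidelity φ ψ

/-! ### Stabilizer product groups and their bases -/

/-- The three non-identity single-qubit Pauli operators. -/
inductive Axis where
  | X | Y | Z
  deriving DecidableEq

instance : Fintype Axis :=
  ⟨{.X, .Y, .Z}, fun a => by cases a <;> decide⟩

/-- A non-identity Pauli operator as a Pauli operator. -/
def Axis.toPauli1 : Axis → Pauli1
  | X => Pauli1.X
  | Y => Pauli1.Y
  | Z => Pauli1.Z

/-- The eigenstate of a non-identity Pauli operator for the eigenvalue `+1` (`false`) or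
`-1` (`true`). -/
def Axis.eigenstate : Axis → Bool → Stab1
  | X, false => Stab1.plus
  | X, true => Stab1.minus
  | Y, false => Stab1.plusI
  | Y, true => Stab1.minusI
  | Z, false => Stab1.zero
  | Z, true => Stab1.one

/-- The stabilizer product group `{I, W 0} ⊗ ⋯ ⊗ {I, W (n - 1)}`. -/
def productGroup {n : ℕ} (W : Fin n → Axis) : Finset (Pauli n) :=
  Finset.univ.filter fun P => ∀ i, P i = Pauli1.I ∨ P i = (W i).toPauli1

/-- The element of the basis belonging to `productGroup W` that is labelled by the signs `s`. -/
def basisState {n : ℕ} (W : Fin n → Axis) (s : Fin n → Bool) : StabProd n :=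
  fun i => (W i).eigenstate (s i)

/-- The local span `{I, W 0} ⊗ ⋯ ⊗ {I, W (n - 1)}` of a set `A` of pairwise locally commuting
Pauli strings, where `W i` is the unique non-identity Pauli that occurs at position `i` of an
element of `A`, and `I` if there is none. -/
def localSpan {n : ℕ} (A : Finset (Pauli n)) : Finset (Pauli n) :=
  Finset.univ.filter fun Q => ∀ i, Q i = Pauli1.I ∨ ∃ P ∈ A, Q i = P i

/-- The stabilizer product groups (given by their full-weight Paulis) that extend `S`. -/
def extensions {n : ℕ} (S : Finset (Pauli n)) : Finset (Fin n → Axis) :=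
  Finset.univ.filter fun W => S ⊆ productGroup W

/-! ### Measurements -/

/-- The expectation value `⟨ψ|P|ψ⟩` (a real number, as `P` is Hermitian). -/
noncomputable def expectation {n : ℕ} (ψ : PureState n) (P : Pauli n) : ℝ :=
  (star ψ.vec.ofLp ⬝ᵥ (P.mat.mulVec ψ.vec.ofLp)).re

/-- `p_ψ(P) = ⟨ψ|P|ψ⟩² / 2^n`. -/
noncomputable def pDist {n : ℕ} (ψ : PureState n) (P : Pauli n) : ℝ :=
  expectation ψ P ^ 2 / 2 ^ n

/-- `q_ψ(P) = ∑_Q p_ψ(Q) p_ψ(PQ)`, with the product `PQ` taken modulo phase. -/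
noncomputable def qDist {n : ℕ} (ψ : PureState n) (P : Pauli n) : ℝ :=
  ∑ Q : Pauli n, pDist ψ Q * pDist ψ (P.mul Q)

theorem sum_normSq (n : ℕ) (ψ : PureState n) :
    ∑ x, ψ.vec.ofLp x * star (ψ.vec.ofLp x) = 1 := by
  have h := EuclideanSpace.norm_sq_eq ψ.vec
  rw [ψ.norm_eq_one] at h
  have h2 : ∀ x, ψ.vec.ofLp x * star (ψ.vec.ofLp x) = ((‖ψ.vec.ofLp x‖ ^ 2 : ℝ) : ℂ) := by
    intro x
    have := Complex.mul_conj (ψ.vec.ofLp x)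
    rw [Complex.normSq_eq_norm_sq] at this
    exact this
  simp_rw [h2]
  rw [← Complex.ofReal_sum, ← h]
  norm_num

theorem Pauli1.mat_star (P : Pauli1) (x y : Fin 2) : star (P.mat x y) = P.mat y x := by
  cases P <;> fin_cases x <;> fin_cases y <;> simp [Pauli1.mat]

theorem Pauli1.sum_mat (x y z w : Fin 2) :
    ∑ P : Pauli1, P.mat x y * P.mat z w = if x = w ∧ y = z then 2 else 0 := by
  have hu : (Finset.univ : Finset Pauli1) = {I, X, Y, Z} := by decide
  rw [hu]
  fin_cases x <;> fin_cases y <;> fin_cases z <;> fin_cases w <;> simp [Pauli1.mat] <;> norm_num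

theorem Pauli.sum_mat {n : ℕ} (x y z w : Fin n → Fin 2) :
    ∑ P : Pauli n, P.mat x y * P.mat z w = if x = w ∧ y = z then 2 ^ n else 0 := by
  have h : ∏ i : Fin n, ∑ P : Pauli1, P.mat (x i) (y i) * P.mat (z i) (w i)
      = ∑ P : Pauli n, P.mat x y * P.mat z w := by
    rw [Finset.prod_univ_sum, Fintype.piFinset_univ]
    simp only [Pauli.mat, Finset.prod_mul_distrib]
  rw [← h]
  simp_rw [Pauli1.sum_mat]
  split_ifs with hc
  · obtain ⟨rfl, rfl⟩ := hc
    simp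
  · have : ∃ i, ¬ (x i = w i ∧ y i = z i) := by
      by_contra hcon
      push Not at hcon
      exact hc ⟨funext fun i => (hcon i).1, funext fun i => (hcon i).2⟩
    obtain ⟨i, hi⟩ := this
    exact Finset.prod_eq_zero (Finset.mem_univ i) (if_neg hi)

theorem expectation_ofReal {n : ℕ} (ψ : PureState n) (P : Pauli n) :
    ((expectation ψ P : ℝ) : ℂ) =
      ∑ x, ∑ y, star (ψ.vec.ofLp x) * P.mat x y * ψ.vec.ofLp y := by
  have he : star ψ.vec.ofLp ⬝ᵥ (P.mat.mulVec ψ.vec.ofLp) =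
      ∑ x, ∑ y, star (ψ.vec.ofLp x) * P.mat x y * ψ.vec.ofLp y := by
    simp [dotProduct, Matrix.mulVec, Finset.mul_sum, mul_assoc]
  unfold expectation
  rw [he]
  apply Complex.conj_eq_iff_re.mp
  simp only [map_sum, map_mul]
  rw [Finset.sum_comm]
  refine Finset.sum_congr rfl fun x _ => Finset.sum_congr rfl fun y _ => ?_
  have hs : (starRingEnd ℂ) (P.mat y x) = P.mat x y := by
    simp only [Pauli.mat, map_prod]
    exact Finset.prod_congr rfl fun i _ => Pauli1.mat_star _ _ _
  rw [hs]
  simp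
  ring

theorem sum_pDist {n : ℕ} (ψ : PureState n) : ∑ P : Pauli n, pDist ψ P = 1 := by
  have key : ∑ P : Pauli n, ((expectation ψ P : ℝ) : ℂ) ^ 2 = 2 ^ n := by
    set v := ψ.vec.ofLp with hv
    calc ∑ P : Pauli n, ((expectation ψ P : ℝ) : ℂ) ^ 2
        = ∑ P : Pauli n, ∑ x, ∑ y, ∑ z, ∑ w,
            (star (v x) * v y * star (v z) * v w) * (P.mat x y * P.mat z w) := by
          refine Finset.sum_congr rfl fun P _ => ?_
          rw [expectation_ofReal, sq]
          simp_rw [Finset.sum_mul, Finset.mul_sum]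
          refine Finset.sum_congr rfl fun x _ => Finset.sum_congr rfl fun y _ =>
            Finset.sum_congr rfl fun z _ => Finset.sum_congr rfl fun w _ => ?_
          ring
      _ = ∑ x, ∑ y, ∑ z, ∑ w, (star (v x) * v y * star (v z) * v w) *
            ∑ P : Pauli n, (P.mat x y * P.mat z w) := by
          simp_rw [Finset.mul_sum]
          rw [Finset.sum_comm]
          refine Finset.sum_congr rfl fun x _ => ?_
          rw [Finset.sum_comm]
          refine Finset.sum_congr rfl fun y _ => ?_
          rw [Finset.sum_comm]
          refine Finset.sum_congr rfl fun z _ => ?_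
          rw [Finset.sum_comm]
      _ = ∑ x, ∑ y, (v x * star (v x)) * (v y * star (v y)) * 2 ^ n := by
          refine Finset.sum_congr rfl fun x _ => Finset.sum_congr rfl fun y _ => ?_
          simp_rw [Pauli.sum_mat]
          rw [Finset.sum_eq_single y, Finset.sum_eq_single x]
          · simp; ring
          · intro w _ hw
            rw [if_neg (fun h => hw h.1.symm), mul_zero]
          · simp
          · intro z _ hz
            refine Finset.sum_eq_zero fun w _ => ?_
            rw [if_neg (fun h => hz h.2.symm), mul_zero]
          · simp
      _ = 2 ^ n := by
          simp_rw [← Finset.sum_mul, ← Finset.mul_sum]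
          rw [← Finset.sum_mul, sum_normSq]
          simp
  have key2 : ∑ P : Pauli n, expectation ψ P ^ 2 = 2 ^ n := by exact_mod_cast key
  unfold pDist
  rw [← Finset.sum_div, key2]
  exact div_self (by positivity)

theorem Pauli.mul_mul_cancel {n : ℕ} (P Q : Pauli n) : (P.mul Q).mul Q = P := by
  funext i
  have : ∀ a b : Pauli1, (a.mul b).mul b = a := by decide
  exact this _ _

theorem sum_qDist {n : ℕ} (ψ : PureState n) : ∑ P : Pauli n, qDist ψ P = 1 := by
  unfold qDist
  rw [Finset.sum_comm]
  have h : ∀ Q : Pauli n, ∑ P : Pauli n, pDist ψ (P.mul Q) = 1 := by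
    intro Q
    rw [← sum_pDist ψ]
    exact Fintype.sum_bijective (fun P : Pauli n => P.mul Q)
      (Function.Involutive.bijective fun P => P.mul_mul_cancel Q) _ _ fun _ => rfl
  simp_rw [← Finset.mul_sum, h, mul_one]
  exact sum_pDist ψ

theorem pDist_nonneg {n : ℕ} (ψ : PureState n) (P : Pauli n) : 0 ≤ pDist ψ P := by
  unfold pDist
  positivity

theorem qDist_nonneg {n : ℕ} (ψ : PureState n) (P : Pauli n) : 0 ≤ qDist ψ P :=
  Finset.sum_nonneg fun _ _ => mul_nonneg (pDist_nonneg _ _) (pDist_nonneg _ _)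

/-- Bell difference sampling: consumes four copies of `ψ` and returns the Pauli string `P` with
probability `q_ψ(P)`. -/
noncomputable def bellDifferenceSample {n : ℕ} (ψ : PureState n) : PMF (Pauli n) :=
  PMF.ofFintype (fun P => ENNReal.ofReal (qDist ψ P)) (by
    rw [← ENNReal.ofReal_sum_of_nonneg fun P _ => qDist_nonneg ψ P, sum_qDist]
    exact ENNReal.ofReal_one)

theorem Axis.sum_eigenstate (W : Axis) (x y : Fin 2) :
    ∑ s : Bool, star ((W.eigenstate s).amp x) * (W.eigenstate s).amp y
      = if x = y then 1 else 0 := by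
  have h2 : ((Real.sqrt 2 : ℝ) : ℂ) * ((Real.sqrt 2 : ℝ) : ℂ) = 2 := by
    rw [← Complex.ofReal_mul, Real.mul_self_sqrt (by norm_num)]
    norm_num
  have h0 : ((Real.sqrt 2 : ℝ) : ℂ) ≠ 0 := by
    intro h
    rw [h] at h2
    norm_num at h2
  cases W <;> fin_cases x <;> fin_cases y <;>
    simp [Axis.eigenstate, Stab1.amp, Complex.conj_ofReal] <;>
    field_simp <;> simp [sq, h2] <;> norm_num

theorem sum_fidelity_basisState {n : ℕ} (ψ : PureState n) (W : Fin n → Axis) :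
    ∑ s : Fin n → Bool, fidelity (basisState W s) ψ = 1 := by
  set v := ψ.vec.ofLp with hv
  have hk : ∀ x y : Fin n → Fin 2, ∑ s : Fin n → Bool,
      star ((basisState W s).vec.ofLp x) * (basisState W s).vec.ofLp y
        = if x = y then 1 else 0 := by
    intro x y
    have h : ∏ i : Fin n, ∑ s : Bool, star (((W i).eigenstate s).amp (x i)) *
        ((W i).eigenstate s).amp (y i)
        = ∑ s : Fin n → Bool,
          star ((basisState W s).vec.ofLp x) * (basisState W s).vec.ofLp y := by
      rw [Finset.prod_univ_sum, Fintype.piFinset_univ]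
      simp only [StabProd.vec, basisState, Finset.prod_mul_distrib, star_prod]
    rw [← h]
    simp_rw [Axis.sum_eigenstate]
    split_ifs with hc
    · subst hc; simp
    · obtain ⟨i, hi⟩ := Function.ne_iff.mp hc
      exact Finset.prod_eq_zero (Finset.mem_univ i) (if_neg hi)
  have hf : ∀ s, ((fidelity (basisState W s) ψ : ℝ) : ℂ) = ∑ x, ∑ y,
      (v x * star (v y)) *
        (star ((basisState W s).vec.ofLp x) * (basisState W s).vec.ofLp y) := by
    intro s
    unfold fidelity
    rw [← Complex.normSq_eq_norm_sq, ← Complex.mul_conj]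
    have hi : inner ℂ (basisState W s).vec ψ.vec
        = ∑ x, star ((basisState W s).vec.ofLp x) * v x := by
      rw [EuclideanSpace.inner_eq_star_dotProduct]
      simp [dotProduct, hv, mul_comm]
    rw [hi, map_sum, Finset.sum_mul_sum]
    refine Finset.sum_congr rfl fun x _ => Finset.sum_congr rfl fun y _ => ?_
    simp
    ring
  have key : ((∑ s : Fin n → Bool, fidelity (basisState W s) ψ : ℝ) : ℂ) = 1 := by
    rw [Complex.ofReal_sum]
    simp_rw [hf]
    rw [Finset.sum_comm, ← sum_normSq n ψ]
    refine Finset.sum_congr rfl fun x _ => ?_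
    rw [Finset.sum_comm]
    simp_rw [← Finset.mul_sum, hk]
    simp [hv]
  exact_mod_cast key

theorem fidelity_nonneg {n : ℕ} (φ : StabProd n) (ψ : PureState n) : 0 ≤ fidelity φ ψ := by
  unfold fidelity
  positivity

/-- Measuring one copy of `ψ` in the basis belonging to `productGroup W`: the outcome `s`, which
stands for the basis element `basisState W s`, has probability `|⟨basisState W s|ψ⟩|²`. -/
noncomputable def measureBasis {n : ℕ} (ψ : PureState n) (W : Fin n → Axis) :
    PMF (Fin n → Bool) :=
  PMF.ofFintype (fun s => ENNReal.ofReal (fidelity (basisState W s) ψ)) (by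
    rw [← ENNReal.ofReal_sum_of_nonneg fun s _ => fidelity_nonneg _ ψ, sum_fidelity_basisState]
    exact ENNReal.ofReal_one)

/-! ### Loops of randomized programs -/

/-- `m` independent runs of `q`. -/
noncomputable def iid {α : Type} (q : PMF α) : (m : ℕ) → PMF (Fin m → α)
  | 0 => PMF.pure Fin.elim0
  | m + 1 => q.bind fun a => (iid q m).bind fun f => PMF.pure (Fin.cons a f)

/-- Runs `body a` for every `a` of the list, in order and each time with fresh randomness, and
concatenates the lists of results. -/
noncomputable def forEach {α β : Type} (body : α → PMF (List β)) : List α → PMF (List β)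
  | [] => PMF.pure []
  | a :: l => (body a).bind fun r => (forEach body l).bind fun r' => PMF.pure (r ++ r')

/-! ### The algorithm -/

/-- The binary entropy `H(p)`, with logarithms to base 2. -/
noncomputable def binEntropy2 (p : ℝ) : ℝ := Real.binEntropy p / Real.log 2

/-- `m_outer = log_{3/4}(δ/2)`, rounded up. -/
noncomputable def mOuter (δ : ℝ) : ℕ := ⌈Real.logb (3 / 4) (δ / 2)⌉₊

/-- `k = log_p(1/(2n))`, rounded up. -/
noncomputable def cliqueSize (n : ℕ) (p : ℝ) : ℕ := ⌈Real.logb p (1 / (2 * n))⌉₊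

/-- `m_clique = (k + 1)/τ⁴`, rounded up. -/
noncomputable def mClique (n : ℕ) (τ p : ℝ) : ℕ := ⌈(1 / τ ^ 4) * ((cliqueSize n p : ℝ) + 1)⌉₊

/-- `t = 4 log₂(1/τ) / (1 - H(p))`. -/
noncomputable def tParam (τ p : ℝ) : ℝ := 4 * Real.logb 2 (1 / τ) / (1 - binEntropy2 p)

/-- `m_est = 8 log(4 m_outer (m_clique choose k) 3^t / δ) / ε²`, rounded up. -/
noncomputable def mEst (n : ℕ) (ε τ p δ : ℝ) : ℕ :=
  ⌈8 * Real.log (4 * (mOuter δ : ℝ) * ((mClique n τ p).choose (cliqueSize n p) : ℝ) *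
    (3 : ℝ) ^ tParam τ p / δ) / ε ^ 2⌉₊

/-- The graph with one vertex for every sample, where two samples are adjacent if and only if they
commute locally. -/
def sampleGraph {n m : ℕ} (V : Fin m → Pauli n) : SimpleGraph (Fin m) :=
  SimpleGraph.fromRel fun i j => localNoncomm (V i) (V j) = 0

/-- The fraction of the outcomes `o` that are equal to `s`. -/
noncomputable def empirical {n m : ℕ} (o : Fin m → Fin n → Bool) (s : Fin n → Bool) : ℝ :=
  ((Finset.univ.filter fun j => o j = s).card : ℝ) / m

/-- Measures `m` copies of `ψ` in the basis belonging to `productGroup W` and records every basis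
state together with its empirical probability. -/
noncomputable def estimateBasis {n : ℕ} (ψ : PureState n) (m : ℕ) (W : Fin n → Axis) :
    PMF (List (StabProd n × ℝ)) :=
  (iid (measureBasis ψ W) m).map fun o =>
    (Finset.univ : Finset (Fin n → Bool)).toList.map fun s => (basisState W s, empirical o s)

open Classical in
/-- One iteration of the outer loop. -/
noncomputable def outerIteration {n : ℕ} (ψ : PureState n) (ε τ p δ : ℝ) :
    PMF (List (StabProd n × ℝ)) :=
  (iid (bellDifferenceSample ψ) (mClique n τ p)).bind fun V =>
    forEach
      (fun C : Finset (Fin (mClique n τ p)) =>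
        let S := localSpan (C.image V)
        if (n : ℝ) - tParam τ p ≤ Real.logb 2 (S.card : ℝ) then
          forEach (estimateBasis ψ (mEst n ε τ p δ)) (extensions S).toList
        else PMF.pure [])
      ((sampleGraph V).cliqueFinset (cliqueSize n p)).toList

/-- The recorded state of maximal empirical probability, and `|0⋯0⟩` if nothing was recorded. -/
noncomputable def bestRecord {n : ℕ} (L : List (StabProd n × ℝ)) : StabProd n :=
  match L.argmax Prod.snd with
  | some r => r.1
  | none => fun _ => Stab1.zero

/-- The law of the output of Stabilizer Product State Approximation on copies of `ψ`. -/
noncomputable def stabProdApprox {n : ℕ} (ψ : PureState n) (ε τ p δ : ℝ) : PMF (StabProd n) :=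
  (forEach (fun _ : ℕ => outerIteration ψ ε τ p δ) (List.range (mOuter δ))).map bestRecord

end StabProdTomography

namespace StabProdTomography

/-! ### Expectations of independent samples -/

/-! Let the maximal fidelity F ≥ τ be attained at `basisState W s`, and let G be the group
`productGroup W`. The projector onto this state is the signed average of G, so Cauchy–Schwarz gives
F² ≤ ∑_G p_ψ (`fidelity_sq_le_sum_pDist`). Closure of G under multiplication gives (∑_G p_ψ)² ≤ ∑_G
q_ψ (`sq_sum_pDist_le_sum_qDist`). Hence a Bell difference sample lies in G with probability θ ≥ τ⁴.

Since q_ψ ≤ 2⁻ⁿ, the samples conditioned on G form a distribution on n-bit strings with no atom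
above 2⁻ⁿ/τ⁴. Comparing it with a product distribution shows that at most t qubits carry the
identity with conditional probability above p (`card_biased_le`). On any other qubit, k samples from
G are all trivial with probability at most pᵏ ≤ 1/(2n), so a union bound leaves probability 1/2 that
k such samples are jointly nontrivial on all these qubits (`half_binomTail_le_piExp`). At least k of
the samples lie in G with probability at least 1/2, because the mean number is at least k
(`half_le_binomTail`). So with probability at least 1/4 one iteration finds a clique whose local
span passes the size test and extends to G, and the optimal state is recorded. The outer repetitions
reduce the probability of missing it to δ/2.

The recorded fractions are uniformly accurate to ε/2 within one basis by a bounded-difference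
argument, at a cost independent of the 2ⁿ outcomes (`piExp_exists_dev_le`). At most 3ᵗ groups extend
an accepted span (`card_extensions_le`), so a union bound over all measured bases costs another δ/2.
Outside these two events, the record of largest fraction loses at most ε/2 twice. -/

/-- The expectation of `f` on `m` independent samples with weights `w`. -/
noncomputable def piExp {α : Type} [Fintype α] (w : α → ℝ) (m : ℕ) (f : (Fin m → α) → ℝ) : ℝ :=
  ∑ x : Fin m → α, (∏ i, w (x i)) * f x

section PiExp

variable {α : Type} [Fintype α] {w : α → ℝ}

theorem piExp_zero (f : (Fin 0 → α) → ℝ) : piExp w 0 f = f Fin.elim0 := by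
  unfold piExp
  rw [Fintype.sum_unique]
  simp only [Finset.univ_eq_empty, Finset.prod_empty, one_mul]
  exact congrArg f (Subsingleton.elim _ _)

theorem piExp_succ (m : ℕ) (f : (Fin (m + 1) → α) → ℝ) :
    piExp w (m + 1) f = ∑ a, w a * piExp w m fun y => f (Fin.cons a y) := by
  unfold piExp
  rw [← (Fin.consEquiv fun _ : Fin (m + 1) => α).sum_comp, Fintype.sum_prod_type]
  refine Finset.sum_congr rfl fun a _ => ?_
  rw [Finset.mul_sum]
  refine Finset.sum_congr rfl fun y _ => ?_
  simp [Fin.consEquiv, Fin.prod_univ_succ, mul_assoc]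

theorem piExp_mono (hw : ∀ a, 0 ≤ w a) {m : ℕ} {f g : (Fin m → α) → ℝ} (h : ∀ x, f x ≤ g x) :
    piExp w m f ≤ piExp w m g :=
  Finset.sum_le_sum fun x _ =>
    mul_le_mul_of_nonneg_left (h x) (Finset.prod_nonneg fun i _ => hw (x i))

theorem piExp_const_mul (m : ℕ) (c : ℝ) (f : (Fin m → α) → ℝ) :
    (piExp w m fun x => c * f x) = c * piExp w m f := by
  unfold piExp
  rw [Finset.mul_sum]
  exact Finset.sum_congr rfl fun x _ => by ring

theorem piExp_add (m : ℕ) (f g : (Fin m → α) → ℝ) :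
    (piExp w m fun x => f x + g x) = piExp w m f + piExp w m g := by
  unfold piExp
  rw [← Finset.sum_add_distrib]
  exact Finset.sum_congr rfl fun x _ => by ring

theorem piExp_sum {ι : Type} (s : Finset ι) (m : ℕ) (f : ι → (Fin m → α) → ℝ) :
    (piExp w m fun x => ∑ i ∈ s, f i x) = ∑ i ∈ s, piExp w m (f i) := by
  unfold piExp
  simp_rw [Finset.mul_sum]
  exact Finset.sum_comm

theorem piExp_const (h1 : ∑ a, w a = 1) (m : ℕ) (c : ℝ) : (piExp w m fun _ => c) = c := by
  induction m with
  | zero => exact piExp_zero _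
  | succ m ih => rw [piExp_succ]; simp_rw [ih]; rw [← Finset.sum_mul, h1, one_mul]

theorem piExp_sq_le (hw : ∀ a, 0 ≤ w a) (h1 : ∑ a, w a = 1) (m : ℕ) (f : (Fin m → α) → ℝ) :
    piExp w m f ^ 2 ≤ piExp w m fun x => f x ^ 2 := by
  have h : 0 ≤ piExp w m fun x => (f x - piExp w m f) ^ 2 := by
    have := piExp_mono (m := m) hw (f := fun _ => (0 : ℝ)) (g := fun x => (f x - piExp w m f) ^ 2)
      fun x => sq_nonneg _
    rwa [piExp_const h1] at this
  have e : (fun x => (f x - piExp w m f) ^ 2) = fun x =>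
      f x ^ 2 + ((-2 * piExp w m f) * f x + piExp w m f ^ 2) := by
    funext x; ring
  rw [e, piExp_add, piExp_add, piExp_const_mul, piExp_const h1] at h
  nlinarith

/-- The variance of a sum of independent centred variables. -/
theorem piExp_sum_sq (h1 : ∑ a, w a = 1) {g : α → ℝ} (hg : ∑ a, w a * g a = 0) (m : ℕ) :
    (piExp w m fun x => (∑ i, g (x i)) ^ 2) = m * ∑ a, w a * g a ^ 2 := by
  induction m with
  | zero => rw [piExp_zero]; simp
  | succ m ih =>
    rw [piExp_succ]
    have e : ∀ a, (piExp w m fun y => (∑ i, g ((Fin.cons a y : Fin (m + 1) → α) i)) ^ 2)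
        = g a ^ 2 + (2 * g a * piExp w m (fun y => ∑ i, g (y i)) + m * ∑ a, w a * g a ^ 2) := by
      intro a
      rw [← ih, ← piExp_const_mul, ← piExp_add, ← piExp_const (w := w) h1 m (g a ^ 2), ← piExp_add]
      congr 1
      funext y
      rw [Fin.sum_univ_succ]
      simp only [Fin.cons_zero, Fin.cons_succ]
      ring
    simp_rw [e, mul_add, Finset.sum_add_distrib]
    have e2 : ∑ a, w a * (2 * g a * piExp w m (fun y => ∑ i, g (y i))) = 0 := by
      have : ∀ a, w a * (2 * g a * piExp w m (fun y => ∑ i, g (y i)))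
          = (w a * g a) * (2 * piExp w m (fun y => ∑ i, g (y i))) := fun a => by ring
      simp_rw [this]
      rw [← Finset.sum_mul, hg, zero_mul]
    rw [e2, ← Finset.sum_mul, h1]
    push_cast
    ring

/-- Hoeffding's lemma for a weighted finite sum. -/
theorem sum_exp_le (hw : ∀ a, 0 ≤ w a) (h1 : ∑ a, w a = 1) {g : α → ℝ} {c : ℝ}
    (hg : ∀ a b, g a - g b ≤ c) (l : ℝ) :
    ∑ a, w a * Real.exp (l * g a) ≤ Real.exp (l * ∑ a, w a * g a + l ^ 2 * c ^ 2 / 8) := by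
  classical
  let _ : MeasurableSpace α := ⊤
  have hs : ∑ a, ENNReal.ofReal (w a) = 1 := by
    rw [← ENNReal.ofReal_sum_of_nonneg fun a _ => hw a, h1, ENNReal.ofReal_one]
  set P : PMF α := PMF.ofFintype (fun a => ENNReal.ofReal (w a)) hs with hP
  have hint : ∀ f : α → ℝ, ∫ a, f a ∂P.toMeasure = ∑ a, w a * f a := by
    intro f
    rw [PMF.integral_eq_sum]
    refine Finset.sum_congr rfl fun a _ => ?_
    rw [hP, PMF.ofFintype_apply, ENNReal.toReal_ofReal (hw a), smul_eq_mul]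
  have hne : Nonempty α := by
    by_contra h
    rw [not_nonempty_iff] at h
    simp at h1
  -- The oscillation bound confines `g` to an interval of length `c` starting at its minimum, which
  -- gives the sub-Gaussian parameter (c/2)².
  obtain ⟨a0, -, ha0⟩ := Finset.exists_min_image Finset.univ g Finset.univ_nonempty
  have hsub := ProbabilityTheory.hasSubgaussianMGF_of_mem_Icc (μ := P.toMeasure) (X := g)
    (a := g a0) (b := g a0 + c) (measurable_from_top.aemeasurable)
    (Filter.Eventually.of_forall fun a => ⟨ha0 a (Finset.mem_univ a), by linarith [hg a a0]⟩)
  have h2 := hsub.mgf_le l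
  rw [ProbabilityTheory.mgf, hint, hint] at h2
  have e1 : ((((‖g a0 + c - g a0‖₊ / 2) ^ 2 : NNReal) : ℝ)) * l ^ 2 / 2 = l ^ 2 * c ^ 2 / 8 := by
    simp [div_pow]
    ring
  rw [e1] at h2
  have e2 : ∑ a, w a * Real.exp (l * g a) = Real.exp (l * ∑ a, w a * g a) *
      ∑ a, w a * Real.exp (l * (g a - ∑ a, w a * g a)) := by
    rw [Finset.mul_sum]
    refine Finset.sum_congr rfl fun a _ => ?_
    rw [mul_left_comm, ← Real.exp_add]
    ring_nf
  rw [e2, Real.exp_add]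
  exact mul_le_mul_of_nonneg_left h2 (Real.exp_pos _).le

/-- The exponential moment bound behind McDiarmid's inequality. -/
theorem piExp_exp_le (hw : ∀ a, 0 ≤ w a) (h1 : ∑ a, w a = 1) {c : ℝ} (l : ℝ) (m : ℕ)
    (f : (Fin m → α) → ℝ)
    (hf : ∀ x y i, (∀ j, j ≠ i → x j = y j) → f x - f y ≤ c) :
    (piExp w m fun x => Real.exp (l * f x)) ≤
      Real.exp (l * piExp w m f + m * (l ^ 2 * c ^ 2 / 8)) := by
  induction m with
  | zero => simp [piExp_zero]
  | succ m ih =>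
    rw [piExp_succ, piExp_succ]
    -- The martingale step: `g` is the conditional expectation given the first sample. It still
    -- oscillates by at most `c`, since two first samples can be compared along the same tail.
    set g : α → ℝ := fun a => piExp w m fun y => f (Fin.cons a y) with hg
    have hgc : ∀ a b, g a - g b ≤ c := by
      intro a b
      have : g a ≤ c + g b := by
        rw [hg]
        dsimp only
        nth_rewrite 1 [← piExp_const (w := w) h1 m c]
        rw [← piExp_add]
        refine piExp_mono hw fun y => ?_
        have := hf (Fin.cons a y) (Fin.cons b y) 0 fun j hj => by
          obtain ⟨j, rfl⟩ := Fin.exists_succ_eq.2 hj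
          simp
        linarith
      linarith
    calc ∑ a, w a * piExp w m (fun y => Real.exp (l * f (Fin.cons a y)))
        ≤ ∑ a, w a * Real.exp (l * g a + m * (l ^ 2 * c ^ 2 / 8)) := by
          refine Finset.sum_le_sum fun a _ => mul_le_mul_of_nonneg_left (ih _ ?_) (hw a)
          intro x y i hxy
          refine hf _ _ i.succ fun j hj => ?_
          refine Fin.cases ?_ (fun j hj => ?_) j hj
          · simp
          · simpa using hxy j fun h => hj (by rw [h])
      _ = (∑ a, w a * Real.exp (l * g a)) * Real.exp (m * (l ^ 2 * c ^ 2 / 8)) := by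
          rw [Finset.sum_mul]
          exact Finset.sum_congr rfl fun a _ => by rw [Real.exp_add]; ring
      _ ≤ Real.exp (l * ∑ a, w a * g a + l ^ 2 * c ^ 2 / 8) *
            Real.exp (m * (l ^ 2 * c ^ 2 / 8)) :=
          mul_le_mul_of_nonneg_right (sum_exp_le hw h1 hgc l) (Real.exp_pos _).le
      _ = _ := by rw [← Real.exp_add]; congr 1; push_cast; ring

/-! ### Empirical frequencies and their uniform deviation -/

/-- The fraction of the entries of `x` that are equal to `s`. -/
noncomputable def freq {α : Type} [DecidableEq α] {m : ℕ} (x : Fin m → α) (s : α) : ℝ :=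
  ((Finset.univ.filter fun j => x j = s).card : ℝ) / m

theorem freq_eq_sum {α : Type} [DecidableEq α] {m : ℕ} (x : Fin m → α) (s : α) :
    freq x s = (∑ j, if x j = s then (1 : ℝ) else 0) / m := by
  unfold freq
  rw [Finset.sum_boole]

theorem abs_freq_sub_freq_le {α : Type} [DecidableEq α] {m : ℕ} {x y : Fin m → α} {i : Fin m}
    (h : ∀ j, j ≠ i → x j = y j) (s : α) : |freq x s - freq y s| ≤ 1 / m := by
  rw [freq_eq_sum, freq_eq_sum, ← sub_div, ← Finset.sum_sub_distrib,
    Finset.sum_eq_single i (fun j _ hj => by rw [h j hj, sub_self]) (by simp), abs_div,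
    abs_of_nonneg (Nat.cast_nonneg m : (0 : ℝ) ≤ m)]
  gcongr
  split_ifs <;> norm_num

/-- Each frequency has variance at most `w s / m`, and these bounds sum to `1 / m` whatever the
number of outcomes. This is what spares a union bound over the outcomes. -/
theorem piExp_sum_freq_sq_le [DecidableEq α] (hw : ∀ a, 0 ≤ w a) (h1 : ∑ a, w a = 1) {m : ℕ}
    (hm : 0 < m) : (piExp w m fun x => ∑ s, (freq x s - w s) ^ 2) ≤ 1 / m := by
  have hm' : (0 : ℝ) < m := by exact_mod_cast hm
  rw [piExp_sum]
  have e : ∀ s, (piExp w m fun x => (freq x s - w s) ^ 2) ≤ 1 / m * w s := by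
    intro s
    have hs : ∑ a, w a * (if a = s then (1 : ℝ) else 0) = w s := by simp
    have hg : ∑ a, w a * ((if a = s then (1 : ℝ) else 0) - w s) = 0 := by
      simp_rw [mul_sub, Finset.sum_sub_distrib]
      rw [hs, ← Finset.sum_mul, h1]
      ring
    have hf : (fun x : Fin m → α => (freq x s - w s) ^ 2)
        = fun x => (1 / (m : ℝ) ^ 2) * (∑ i, ((if x i = s then (1 : ℝ) else 0) - w s)) ^ 2 := by
      funext x
      rw [freq_eq_sum, Finset.sum_sub_distrib]
      simp only [Finset.sum_const, Finset.card_univ, Fintype.card_fin, nsmul_eq_mul]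
      field_simp
    rw [hf, piExp_const_mul, piExp_sum_sq h1 hg]
    have hv : ∑ a, w a * ((if a = s then (1 : ℝ) else 0) - w s) ^ 2 ≤ w s := by
      have : ∀ a, w a * ((if a = s then (1 : ℝ) else 0) - w s) ^ 2
          = (1 - w s) * (w a * (if a = s then (1 : ℝ) else 0))
            - w s * (w a * ((if a = s then (1 : ℝ) else 0) - w s)) := by
        intro a
        split_ifs <;> ring
      simp_rw [this]
      rw [Finset.sum_sub_distrib, ← Finset.mul_sum, ← Finset.mul_sum, hg, hs]
      nlinarith [hw s]
    calc 1 / (m : ℝ) ^ 2 * (m * ∑ a, w a * ((if a = s then (1 : ℝ) else 0) - w s) ^ 2)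
        = 1 / m * ∑ a, w a * ((if a = s then (1 : ℝ) else 0) - w s) ^ 2 := by field_simp
      _ ≤ 1 / m * w s := by gcongr
  calc _ ≤ ∑ s, 1 / (m : ℝ) * w s := Finset.sum_le_sum fun s _ => e s
    _ = 1 / m := by rw [← Finset.mul_sum, h1, mul_one]

open Classical in
/-- Uniform concentration of the empirical frequencies. -/
theorem piExp_exists_dev_le (hw : ∀ a, 0 ≤ w a) (h1 : ∑ a, w a = 1) {m : ℕ} {η : ℝ}
    (hη : 0 < η) (hm : 2 ≤ m * η ^ 2) :
    (piExp w m fun x => if ∃ s, η < |freq x s - w s| then 1 else 0) ≤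
      2 * Real.exp (-(m * η ^ 2 / 2)) := by
  have hmpos : 0 < m := by
    rcases Nat.eq_zero_or_pos m with rfl | h
    · norm_num at hm
    · exact h
  have hm' : (0 : ℝ) < m := by exact_mod_cast hmpos
  have hne : Nonempty α := by
    by_contra h
    rw [not_nonempty_iff] at h
    simp at h1
  set Z : (Fin m → α) → ℝ := fun x =>
    Finset.univ.sup' Finset.univ_nonempty fun s => |freq x s - w s| with hZ
  have hle : ∀ x s, |freq x s - w s| ≤ Z x := fun x s =>
    Finset.le_sup' (fun s => |freq x s - w s|) (Finset.mem_univ s)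
  have hex : ∀ x, ∃ s, Z x = |freq x s - w s| := fun x => by
    obtain ⟨s, -, hs⟩ := Finset.exists_mem_eq_sup' Finset.univ_nonempty fun s => |freq x s - w s|
    exact ⟨s, hs⟩
  have hdiff : ∀ x y i, (∀ j, j ≠ i → x j = y j) → Z x - Z y ≤ 1 / m := by
    intro x y i h
    obtain ⟨s, hs⟩ := hex x
    have h2 := abs_freq_sub_freq_le h s
    have h3 := hle y s
    have h4 := abs_sub_le (freq x s) (freq y s) (w s)
    linarith
  have hmean : piExp w m Z ^ 2 ≤ 1 / m := by
    refine (piExp_sq_le hw h1 m Z).trans ((piExp_mono hw fun x => ?_).trans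
      (piExp_sum_freq_sq_le hw h1 hmpos))
    obtain ⟨s, hs⟩ := hex x
    rw [hs, sq_abs]
    exact Finset.single_le_sum (f := fun s => (freq x s - w s) ^ 2) (fun s _ => sq_nonneg _)
      (Finset.mem_univ s)
  set r := Real.sqrt m with hr
  have hrpos : 0 < r := Real.sqrt_pos.2 hm'
  have hr2 : r ^ 2 = m := Real.sq_sqrt hm'.le
  have hmean' : piExp w m Z ≤ 1 / r := by
    refine abs_le_of_sq_le_sq' ?_ (by positivity) |>.2
    rw [div_pow, one_pow, hr2]
    exact hmean
  have hy : 1 ≤ r * η := by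
    nlinarith [mul_pos hrpos hη]
  -- This minimises the Chernoff exponent −lη + l/r + l²/(8m), where 1/r bounds the mean of `Z` and
  -- 1/m bounds its differences.
  set l : ℝ := 4 * r * (r * η - 1) with hl
  have hl0 : 0 ≤ l := by
    have : 0 ≤ r * η - 1 := by linarith
    positivity
  have hexp := piExp_exp_le (w := w) hw h1 l m Z hdiff
  calc (piExp w m fun x => if ∃ s, η < |freq x s - w s| then (1 : ℝ) else 0)
      ≤ piExp w m fun x => Real.exp (-(l * η)) * Real.exp (l * Z x) := by
        refine piExp_mono hw fun x => ?_
        rw [← Real.exp_add]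
        split_ifs with h
        · obtain ⟨s, hs⟩ := h
          rw [← Real.exp_zero]
          refine Real.exp_le_exp.2 ?_
          nlinarith [hle x s]
        · exact (Real.exp_pos _).le
    _ ≤ Real.exp (-(l * η)) * Real.exp (l * piExp w m Z + m * (l ^ 2 * (1 / m) ^ 2 / 8)) := by
        rw [piExp_const_mul]
        gcongr
    _ ≤ Real.exp (Real.log 2 + -(m * η ^ 2 / 2)) := by
        rw [← Real.exp_add]
        refine Real.exp_le_exp.2 ?_
        have e1 : (m : ℝ) * (l ^ 2 * (1 / m) ^ 2 / 8) = 2 * (r * η - 1) ^ 2 := by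
          rw [hl, ← hr2]
          field_simp
          ring
        have e2 : l * piExp w m Z ≤ 4 * (r * η - 1) := by
          calc l * piExp w m Z ≤ l * (1 / r) := by gcongr
            _ = 4 * (r * η - 1) := by rw [hl]; field_simp
        have e3 : l * η = 4 * (r * η) * (r * η - 1) := by rw [hl]; ring
        have e4 : (m : ℝ) * η ^ 2 = (r * η) ^ 2 := by rw [mul_pow, hr2]
        rw [e1, e3, e4]
        -- With u = rη the exponent is at most −2(u − 1)². It exceeds −u²/2 by at most 2/3, attained
        -- at u = 4/3, and 2/3 < log 2; this is the origin of the prefactor 2.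
        nlinarith [Real.log_two_gt_d9, sq_nonneg (r * η - 4 / 3)]
    _ = _ := by rw [Real.exp_add, Real.exp_log (by norm_num)]

end PiExp

/-! ### Upper tails of the binomial distribution -/

/-- The probability of at least `k` successes in `m` trials with success probability `q`. -/
noncomputable def binomTail (m k : ℕ) (q : ℝ) : ℝ :=
  ∑ j ∈ Finset.Ico k (m + 1), (m.choose j : ℝ) * q ^ j * (1 - q) ^ (m - j)

theorem binomTail_nonneg (m k : ℕ) {q : ℝ} (h0 : 0 ≤ q) (h1 : q ≤ 1) : 0 ≤ binomTail m k q := by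
  have : 0 ≤ 1 - q := by linarith
  exact Finset.sum_nonneg fun j _ => by positivity

theorem binomTail_one {m k : ℕ} (h : k ≤ m) : binomTail m k 1 = 1 := by
  unfold binomTail
  rw [Finset.sum_eq_single m]
  · simp
  · intro j hj hjm
    have : m - j ≠ 0 := by rw [Finset.mem_Ico] at hj; omega
    simp [this]
  · simp [h]

/-- The tail is a sum of Bernstein polynomials, and the derivative of each is a multiple of a
difference of two consecutive ones of degree m − 1. The sum telescopes, and its upper end vanishes
because its index m exceeds the degree. -/
theorem hasDerivAt_binomTail {m k : ℕ} (hk : 1 ≤ k) (hkm : k ≤ m) (q : ℝ) :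
    HasDerivAt (binomTail m k)
      (m * ((m - 1).choose (k - 1) * q ^ (k - 1) * (1 - q) ^ (m - k))) q := by
  obtain ⟨ν, rfl⟩ : ∃ ν, k = ν + 1 := ⟨k - 1, by omega⟩
  have e : binomTail m (ν + 1) = fun q => (∑ j ∈ Finset.Ico ν m,
      bernsteinPolynomial ℝ m (j + 1)).eval q := by
    funext x
    unfold binomTail
    rw [← Finset.sum_Ico_add' _ ν m 1, Polynomial.eval_finsetSum]
    exact Finset.sum_congr rfl fun j _ => by simp [bernsteinPolynomial]
  rw [e]
  refine (Polynomial.hasDerivAt _ q).congr_deriv ?_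
  rw [Polynomial.derivative_sum]
  simp_rw [bernsteinPolynomial.derivative_succ]
  rw [← Finset.mul_sum, Finset.sum_Ico_eq_sum_range]
  have := Finset.sum_range_sub' (fun i => bernsteinPolynomial ℝ (m - 1) (ν + i)) (m - ν)
  simp_rw [← add_assoc] at this
  rw [this, bernsteinPolynomial.eq_zero_of_lt (R := ℝ) (n := m - 1) (ν := ν + (m - ν)) (by omega)]
  have : m - 1 - ν = m - (ν + 1) := by omega
  simp [bernsteinPolynomial, this]

/-- Both sides vanish at y = 1, and the derivative of their difference is a positive multiple of (y
− 1)². -/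
theorem log_ratio_bound {q : ℝ} (hq : 0 < q) {y : ℝ} (hy : 1 ≤ y) (hqy : q * y < 1) :
    2 * q / (1 - q) * Real.log y ≤ Real.log (1 - q / y) - Real.log (1 - q * y) := by
  have hq1 : q < 1 := by nlinarith
  set G : ℝ → ℝ := fun y =>
    Real.log (1 - q / y) - Real.log (1 - q * y) - 2 * q / (1 - q) * Real.log y with hG
  have hpos : ∀ z ∈ Set.Icc 1 y, 0 < z ∧ 0 < 1 - q / z ∧ 0 < 1 - q * z := by
    intro z hz
    have hz0 : 0 < z := by linarith [hz.1]
    refine ⟨hz0, ?_, by nlinarith [hz.2]⟩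
    rw [sub_pos, div_lt_one hz0]
    linarith [hz.1]
  have hder : ∀ z ∈ Set.Icc 1 y, HasDerivAt G
      ((q / z ^ 2) / (1 - q / z) - (-q) / (1 - q * z) - 2 * q / (1 - q) * z⁻¹) z := by
    intro z hz
    obtain ⟨hz0, h1, h2⟩ := hpos z hz
    refine HasDerivAt.sub (HasDerivAt.sub ?_ ?_) ((Real.hasDerivAt_log hz0.ne').const_mul _)
    · refine HasDerivAt.log ?_ h1.ne'
      exact (((hasDerivAt_inv hz0.ne').const_mul q).const_sub 1).congr_deriv (by field_simp)
    · refine HasDerivAt.log ?_ h2.ne'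
      have := ((hasDerivAt_id z).const_mul q).const_sub 1
      simpa using this
  have hmono : MonotoneOn G (Set.Icc 1 y) := by
    refine monotoneOn_of_deriv_nonneg (convex_Icc 1 y)
      (fun z hz => (hder z hz).continuousAt.continuousWithinAt)
      (fun z hz => (hder z (interior_subset hz)).differentiableAt.differentiableWithinAt)
      fun z hz => ?_
    have hz := interior_subset hz
    rw [(hder z hz).deriv]
    obtain ⟨hz0, h1, h2⟩ := hpos z hz
    have h3 : 0 < z - q := by linarith [hz.1]
    have h4 : 0 < 1 - q := by linarith
    have e : (q / z ^ 2) / (1 - q / z) - (-q) / (1 - q * z) - 2 * q / (1 - q) * z⁻¹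
        = q * (1 + q) * (z - 1) ^ 2 / (z * (z - q) * (1 - q * z) * (1 - q)) := by
      have : 1 - q / z = (z - q) / z := by field_simp
      rw [this]
      field_simp
      ring
    rw [e]
    positivity
  have := hmono (Set.left_mem_Icc.2 hy) (Set.right_mem_Icc.2 hy) hy
  simp only [hG, Real.log_one, div_one, mul_one, mul_zero, sub_self] at this
  linarith

/-- Exponentiated form of `log_ratio_bound`: the hypothesis bounds k by b times the odds q/(1 − q).
It compares the derivatives of the binomial tail at qy and at q/y. -/
theorem pow_mul_pow_le {k b : ℕ} {q : ℝ} (hq : 0 < q) (hkb : k * (1 - q) ≤ b * q) {y : ℝ}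
    (hy : 1 ≤ y) (hqy : q * y < 1) : y ^ (2 * k) * (1 - q * y) ^ b ≤ (1 - q / y) ^ b := by
  have hq1 : q < 1 := by nlinarith
  have hy0 : 0 < y := by linarith
  have h2 : 0 < 1 - q * y := by linarith
  have h1 : 0 < 1 - q / y := by
    rw [sub_pos, div_lt_one hy0]
    linarith
  have h3 := log_ratio_bound hq hy hqy
  rw [← Real.log_le_log_iff (by positivity) (by positivity), Real.log_mul (by positivity)
    (by positivity), Real.log_pow, Real.log_pow, Real.log_pow]
  have hl := Real.log_nonneg hy
  have h4 : 0 < 1 - q := by linarith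
  have h5 : (k : ℝ) ≤ b * (q / (1 - q)) := by
    rw [← mul_div_assoc, le_div_iff₀ h4]
    exact hkb
  have h6 : (b : ℝ) * (2 * q / (1 - q) * Real.log y) ≤
      b * (Real.log (1 - q / y) - Real.log (1 - q * y)) :=
    mul_le_mul_of_nonneg_left h3 (Nat.cast_nonneg b)
  have h7 : (k : ℝ) * Real.log y ≤ b * (q / (1 - q)) * Real.log y :=
    mul_le_mul_of_nonneg_right h5 hl
  have h8 : (b : ℝ) * (2 * q / (1 - q) * Real.log y) = 2 * (b * (q / (1 - q)) * Real.log y) := by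
    ring
  push_cast
  linarith

/-- If the mean is at least `k`, then at least `k` successes occur with probability at least
one half. -/
theorem half_le_binomTail {m k : ℕ} (hk : 1 ≤ k) {q : ℝ} (hq : 0 < q) (hq1 : q ≤ 1)
    (hmean : (k : ℝ) ≤ m * q) : 1 / 2 ≤ binomTail m k q := by
  have hkm : k ≤ m := by
    have : (k : ℝ) ≤ m := hmean.trans (mul_le_of_le_one_right (Nat.cast_nonneg m) hq1)
    exact_mod_cast this
  -- Pairing the parameters qy and q/y makes the sum decrease in y: it equals twice the tail at y =
  -- 1, and at y = 1/q it contains the tail at parameter 1, which is 1.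
  set h : ℝ → ℝ := fun y => binomTail m k (q * y) + binomTail m k (q / y) with hh
  set f : ℝ → ℝ := fun x => m * ((m - 1).choose (k - 1) * x ^ (k - 1) * (1 - x) ^ (m - k)) with hf
  have hder : ∀ y ∈ Set.Icc 1 (1 / q),
      HasDerivAt h (f (q * y) * q + f (q / y) * (q * (-(y ^ 2)⁻¹))) y := by
    intro y hy
    have hy0 : y ≠ 0 := by
      have := hy.1
      positivity
    refine HasDerivAt.add ?_ ?_
    · refine (hasDerivAt_binomTail hk hkm (q * y)).comp y ?_
      simpa using (hasDerivAt_id y).const_mul q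
    · exact (hasDerivAt_binomTail hk hkm (q / y)).comp y ((hasDerivAt_inv hy0).const_mul q)
  have hanti : AntitoneOn h (Set.Icc 1 (1 / q)) := by
    refine antitoneOn_of_deriv_nonpos (convex_Icc _ _)
      (fun z hz => (hder z hz).continuousAt.continuousWithinAt)
      (fun z hz => (hder z (interior_subset hz)).differentiableAt.differentiableWithinAt)
      fun y hy => ?_
    rw [(hder y (interior_subset hy)).deriv]
    rw [interior_Icc] at hy
    have hy0 : 0 < y := by linarith [hy.1]
    have hqy : q * y < 1 := by
      have := hy.2
      rw [lt_div_iff₀ hq] at this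
      linarith
    -- With b = m − k, the condition k(1 − q) ≤ bq says exactly that the mean mq is at least k.
    have key := pow_mul_pow_le (k := k) (b := m - k) hq (by
      rw [Nat.cast_sub hkm]
      linarith) hy.1.le hqy
    set A := (1 - q * y) ^ (m - k)
    set B := (1 - q / y) ^ (m - k)
    have e : f (q * y) * q + f (q / y) * (q * (-(y ^ 2)⁻¹))
        = (m * (m - 1).choose (k - 1) * q ^ (k - 1) * q / y ^ (k + 1)) *
          (y ^ (2 * k) * A - B) := by
      obtain ⟨ν, rfl⟩ : ∃ ν, k = ν + 1 := ⟨k - 1, by omega⟩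
      simp only [hf, Nat.add_sub_cancel, mul_pow, div_pow]
      change _ * (_ * _ * A) * q + _ * (_ * _ * B) * _ = _
      field_simp
      ring
    rw [e]
    refine mul_nonpos_of_nonneg_of_nonpos (by positivity) (by linarith)
  have h1q : 1 ≤ 1 / q := by rwa [le_div_iff₀ hq, one_mul]
  have hfin := hanti (Set.left_mem_Icc.2 h1q) (Set.right_mem_Icc.2 h1q) h1q
  simp only [hh, mul_one, div_one] at hfin
  rw [mul_one_div_cancel hq.ne', binomTail_one hkm] at hfin
  have : 0 ≤ binomTail m k (q / (1 / q)) := by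
    have e : q / (1 / q) = q ^ 2 := by field_simp
    rw [e]
    exact binomTail_nonneg _ _ (by positivity) (pow_le_one₀ hq.le hq1)
  linarith

/-! ### Stabilizer product groups and Bell difference sampling -/

/-- The element of `productGroup W` that is the identity exactly where `b` is `true`. -/
def productElem {n : ℕ} (W : Fin n → Axis) (b : Fin n → Bool) : Pauli n :=
  fun i => if b i then Pauli1.I else (W i).toPauli1

theorem Axis.toPauli1_ne (W : Axis) : W.toPauli1 ≠ Pauli1.I := by
  cases W <;> decide

theorem productElem_eq_I {n : ℕ} (W : Fin n → Axis) (b : Fin n → Bool) (i : Fin n) :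
    productElem W b i = Pauli1.I ↔ b i = true := by
  unfold productElem
  split_ifs with h
  · simp [h]
  · simp [h, Axis.toPauli1_ne]

theorem productElem_injective {n : ℕ} (W : Fin n → Axis) : Function.Injective (productElem W) := by
  intro b c h
  funext i
  have h1 := productElem_eq_I W b i
  rw [h, productElem_eq_I] at h1
  exact Bool.eq_iff_iff.2 h1.symm

theorem mem_productGroup {n : ℕ} {W : Fin n → Axis} {P : Pauli n} :
    P ∈ productGroup W ↔ ∀ i, P i = Pauli1.I ∨ P i = (W i).toPauli1 := by
  simp [productGroup]

theorem productElem_mem {n : ℕ} (W : Fin n → Axis) (b : Fin n → Bool) :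
    productElem W b ∈ productGroup W := by
  rw [mem_productGroup]
  intro i
  unfold productElem
  split_ifs
  · exact Or.inl rfl
  · exact Or.inr rfl

theorem exists_productElem {n : ℕ} {W : Fin n → Axis} {P : Pauli n} (h : P ∈ productGroup W) :
    ∃ b, productElem W b = P := by
  rw [mem_productGroup] at h
  refine ⟨fun i => decide (P i = Pauli1.I), funext fun i => ?_⟩
  unfold productElem
  rcases h i with hi | hi
  · simp [hi]
  · simp [hi, Axis.toPauli1_ne]

theorem sum_productGroup {n : ℕ} (W : Fin n → Axis) (f : Pauli n → ℝ) :
    ∑ P ∈ productGroup W, f P = ∑ b, f (productElem W b) := by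
  symm
  refine Finset.sum_bij (fun b _ => productElem W b) (fun b _ => productElem_mem W b)
    (fun b _ c _ h => productElem_injective W h) (fun P hP => ?_) fun _ _ => rfl
  obtain ⟨b, hb⟩ := exists_productElem hP
  exact ⟨b, Finset.mem_univ _, hb⟩

/-! ### Fourier duality between basis fidelities and Pauli expectations -/

/-- The eigenvalue of `productElem W b` at `basisState W s`, one qubit at a time. -/
def eigenSign (b s : Bool) : ℝ := if b then 1 else if s then -1 else 1

theorem eigenSign_sq (b s : Bool) : eigenSign b s ^ 2 = 1 := by
  cases b <;> cases s <;> norm_num [eigenSign]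

theorem sqrt_two_mul_self : ((Real.sqrt 2 : ℝ) : ℂ) * ((Real.sqrt 2 : ℝ) : ℂ) = 2 := by
  rw [← Complex.ofReal_mul, Real.mul_self_sqrt (by norm_num)]
  norm_num

/-- The eigenprojector is (I ± W)/2, written entrywise; the index `true` selects the identity term.
-/
theorem Axis.amp_mul_star (W : Axis) (s : Bool) (x y : Fin 2) :
    (W.eigenstate s).amp x * star ((W.eigenstate s).amp y) =
      ∑ b : Bool, ((eigenSign b s / 2 : ℝ) : ℂ) *
        (if b then Pauli1.I else W.toPauli1).mat x y := by
  have h2 := sqrt_two_mul_self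
  have h0 : ((Real.sqrt 2 : ℝ) : ℂ) ≠ 0 := by
    intro h
    rw [h] at h2
    norm_num at h2
  cases W <;> cases s <;> fin_cases x <;> fin_cases y <;>
    simp [Axis.eigenstate, Stab1.amp, Complex.conj_ofReal, eigenSign, Axis.toPauli1, Pauli1.mat] <;>
    field_simp <;> (try simp [sq, h2]) <;> norm_num

/-- The spectral decomposition of I and of W, inverse to `Axis.amp_mul_star`. -/
theorem Axis.mat_eq_sum (W : Axis) (b : Bool) (x y : Fin 2) :
    (if b then Pauli1.I else W.toPauli1).mat x y =
      ∑ s : Bool, ((eigenSign b s : ℝ) : ℂ) *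
        ((W.eigenstate s).amp x * star ((W.eigenstate s).amp y)) := by
  simp_rw [Axis.amp_mul_star]
  cases b <;> simp [eigenSign] <;> ring

theorem basisState_mul_star {n : ℕ} (W : Fin n → Axis) (s : Fin n → Bool) (x y : Fin n → Fin 2) :
    (basisState W s).vec.ofLp x * star ((basisState W s).vec.ofLp y) =
      ∑ b : Fin n → Bool, ((∏ i, eigenSign (b i) (s i) / 2 : ℝ) : ℂ) *
        (productElem W b).mat x y := by
  simp only [StabProd.vec, basisState, star_prod]
  rw [← Finset.prod_mul_distrib]
  simp_rw [Axis.amp_mul_star]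
  rw [Finset.prod_univ_sum, Fintype.piFinset_univ]
  refine Finset.sum_congr rfl fun b _ => ?_
  rw [Finset.prod_mul_distrib, Complex.ofReal_prod]
  rfl

theorem productElem_mat {n : ℕ} (W : Fin n → Axis) (b : Fin n → Bool) (x y : Fin n → Fin 2) :
    (productElem W b).mat x y =
      ∑ s : Fin n → Bool, ((∏ i, eigenSign (b i) (s i) : ℝ) : ℂ) *
        ((basisState W s).vec.ofLp x * star ((basisState W s).vec.ofLp y)) := by
  simp only [StabProd.vec, basisState, star_prod, Pauli.mat, productElem]
  simp_rw [Axis.mat_eq_sum]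
  rw [Finset.prod_univ_sum, Fintype.piFinset_univ]
  refine Finset.sum_congr rfl fun s _ => ?_
  rw [Finset.prod_mul_distrib, Complex.ofReal_prod, Finset.prod_mul_distrib]

/-- The sesquilinear form of a kernel at a state vector. -/
noncomputable def quadForm {n : ℕ} (ψ : PureState n)
    (K : (Fin n → Fin 2) → (Fin n → Fin 2) → ℂ) : ℂ :=
  ∑ x, ∑ y, star (ψ.vec.ofLp x) * K x y * ψ.vec.ofLp y

theorem quadForm_sum {n : ℕ} (ψ : PureState n) {ι : Type} [Fintype ι] (c : ι → ℂ)
    (K : ι → (Fin n → Fin 2) → (Fin n → Fin 2) → ℂ) :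
    quadForm ψ (fun x y => ∑ i, c i * K i x y) = ∑ i, c i * quadForm ψ (K i) := by
  unfold quadForm
  simp_rw [Finset.mul_sum]
  rw [Finset.sum_comm (γ := ι)]
  refine Finset.sum_congr rfl fun x _ => ?_
  rw [Finset.sum_comm (γ := ι)]
  refine Finset.sum_congr rfl fun y _ => ?_
  rw [Finset.sum_mul]
  exact Finset.sum_congr rfl fun i _ => by ring

theorem fidelity_eq_quadForm {n : ℕ} (φ : StabProd n) (ψ : PureState n) :
    ((fidelity φ ψ : ℝ) : ℂ) = quadForm ψ fun x y => φ.vec.ofLp x * star (φ.vec.ofLp y) := by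
  unfold fidelity
  rw [← Complex.normSq_eq_norm_sq, ← Complex.mul_conj]
  have hi : inner ℂ φ.vec ψ.vec = ∑ x, star (φ.vec.ofLp x) * ψ.vec.ofLp x := by
    rw [EuclideanSpace.inner_eq_star_dotProduct]
    simp [dotProduct, mul_comm]
  rw [hi, map_sum, mul_comm, Finset.sum_mul_sum]
  refine Finset.sum_congr rfl fun x _ => Finset.sum_congr rfl fun y _ => ?_
  simp
  ring

theorem expectation_eq_quadForm {n : ℕ} (ψ : PureState n) (P : Pauli n) :
    ((expectation ψ P : ℝ) : ℂ) = quadForm ψ P.mat :=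
  expectation_ofReal ψ P

theorem fidelity_basisState_eq {n : ℕ} (ψ : PureState n) (W : Fin n → Axis) (s : Fin n → Bool) :
    fidelity (basisState W s) ψ =
      ∑ b, (∏ i, eigenSign (b i) (s i) / 2) * expectation ψ (productElem W b) := by
  have h := fidelity_eq_quadForm (basisState W s) ψ
  simp_rw [basisState_mul_star] at h
  rw [quadForm_sum ψ (fun b => ((∏ i, eigenSign (b i) (s i) / 2 : ℝ) : ℂ))
    (fun b => (productElem W b).mat)] at h
  simp_rw [← expectation_eq_quadForm] at h
  exact_mod_cast h

theorem expectation_productElem_eq {n : ℕ} (ψ : PureState n) (W : Fin n → Axis)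
    (b : Fin n → Bool) :
    expectation ψ (productElem W b) =
      ∑ s, (∏ i, eigenSign (b i) (s i)) * fidelity (basisState W s) ψ := by
  have h := expectation_eq_quadForm ψ (productElem W b)
  have e : (productElem W b).mat = fun x y => ∑ s : Fin n → Bool,
      ((∏ i, eigenSign (b i) (s i) : ℝ) : ℂ) *
        ((basisState W s).vec.ofLp x * star ((basisState W s).vec.ofLp y)) :=
    funext fun x => funext fun y => productElem_mat W b x y
  rw [e, quadForm_sum ψ (fun s => ((∏ i, eigenSign (b i) (s i) : ℝ) : ℂ))
    (fun s x y => (basisState W s).vec.ofLp x * star ((basisState W s).vec.ofLp y))] at h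
  simp_rw [← fidelity_eq_quadForm] at h
  exact_mod_cast h

theorem exists_axis (P : Pauli1) : ∃ (W : Axis) (b : Bool),
    (if b then Pauli1.I else W.toPauli1) = P := by
  cases P
  · exact ⟨.X, true, rfl⟩
  · exact ⟨.X, false, rfl⟩
  · exact ⟨.Y, false, rfl⟩
  · exact ⟨.Z, false, rfl⟩

/-- Every Pauli string lies in some product group, with an arbitrary axis on its identity factors.
Its expectation is then an average of signs under the outcome distribution of that basis. -/
theorem expectation_sq_le_one {n : ℕ} (ψ : PureState n) (P : Pauli n) :
    expectation ψ P ^ 2 ≤ 1 := by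
  choose W b h using fun i => exists_axis (P i)
  have hP : productElem W b = P := funext h
  rw [← hP, sq_le_one_iff_abs_le_one, expectation_productElem_eq]
  refine (Finset.abs_sum_le_sum_abs _ _).trans ?_
  rw [← sum_fidelity_basisState ψ W]
  refine Finset.sum_le_sum fun s _ => ?_
  have h1 : |∏ i, eigenSign (b i) (s i)| = 1 := by
    rw [Finset.abs_prod]
    exact Finset.prod_eq_one fun i _ => (pow_eq_one_iff_of_nonneg (abs_nonneg _) two_ne_zero).1
      (by rw [sq_abs, eigenSign_sq])
  rw [abs_mul, h1, one_mul, abs_of_nonneg (fidelity_nonneg _ _)]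

/-- An average of values of p_ψ, each at most 2⁻ⁿ. This is the source of the min-entropy bound. -/
theorem qDist_le {n : ℕ} (ψ : PureState n) (P : Pauli n) : qDist ψ P ≤ 1 / 2 ^ n := by
  unfold qDist
  calc ∑ Q, pDist ψ Q * pDist ψ (P.mul Q) ≤ ∑ Q, pDist ψ Q * (1 / 2 ^ n) := by
        refine Finset.sum_le_sum fun Q _ => mul_le_mul_of_nonneg_left ?_ (pDist_nonneg ψ Q)
        unfold pDist
        have := expectation_sq_le_one ψ (P.mul Q)
        gcongr
    _ = 1 / 2 ^ n := by rw [← Finset.sum_mul, sum_pDist, one_mul]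

/-- Cauchy–Schwarz on the signed average over the group: the 2ⁿ coefficients are ±2⁻ⁿ, so their
squares sum to 2⁻ⁿ, exactly the normalisation of p_ψ. -/
theorem fidelity_sq_le_sum_pDist {n : ℕ} (ψ : PureState n) (W : Fin n → Axis)
    (s : Fin n → Bool) :
    fidelity (basisState W s) ψ ^ 2 ≤ ∑ P ∈ productGroup W, pDist ψ P := by
  rw [sum_productGroup, fidelity_basisState_eq]
  refine (Finset.sum_mul_sq_le_sq_mul_sq _ _ _).trans (le_of_eq ?_)
  have h : ∀ b : Fin n → Bool, (∏ i, eigenSign (b i) (s i) / 2) ^ 2 = (1 / 4) ^ n := by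
    intro b
    rw [← Finset.prod_pow]
    have : ∀ i, (eigenSign (b i) (s i) / 2) ^ 2 = 1 / 4 := fun i => by
      rw [div_pow, eigenSign_sq]; norm_num
    simp [this]
  simp_rw [h]
  rw [Finset.sum_const, Finset.card_univ, Fintype.card_fun, Fintype.card_bool, Fintype.card_fin,
    nsmul_eq_mul]
  have e : ((2 ^ n : ℕ) : ℝ) * (1 / 4) ^ n = 1 / 2 ^ n := by
    push_cast
    rw [← mul_pow, ← one_div_pow]
    norm_num
  rw [e]
  unfold pDist
  rw [← Finset.sum_div]
  ring

theorem mul_mem_productGroup {n : ℕ} {W : Fin n → Axis} {P Q : Pauli n}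
    (hP : P ∈ productGroup W) (hQ : Q ∈ productGroup W) : P.mul Q ∈ productGroup W := by
  rw [mem_productGroup] at *
  intro i
  have key : ∀ (A : Axis) (a b : Pauli1), (a = .I ∨ a = A.toPauli1) → (b = .I ∨ b = A.toPauli1) →
      (a.mul b = .I ∨ a.mul b = A.toPauli1) := by
    rintro (_ | _ | _) a b (rfl | rfl) (rfl | rfl) <;> decide
  exact key _ _ _ (hP i) (hQ i)

/-- Multiplication by an element of the group permutes the group, so restricting the convolution q_ψ
to factors inside the group already produces the square. -/
theorem sq_sum_pDist_le_sum_qDist {n : ℕ} (ψ : PureState n) (W : Fin n → Axis) :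
    (∑ P ∈ productGroup W, pDist ψ P) ^ 2 ≤ ∑ P ∈ productGroup W, qDist ψ P := by
  calc (∑ P ∈ productGroup W, pDist ψ P) ^ 2
      = ∑ Q ∈ productGroup W, pDist ψ Q * ∑ P ∈ productGroup W, pDist ψ (P.mul Q) := by
        rw [sq, Finset.sum_mul]
        refine Finset.sum_congr rfl fun Q hQ => ?_
        congr 1
        refine Finset.sum_nbij' (fun P => P.mul Q) (fun P => P.mul Q)
          (fun P hP => mul_mem_productGroup hP hQ) (fun P hP => mul_mem_productGroup hP hQ)
          (fun P _ => P.mul_mul_cancel Q) (fun P _ => P.mul_mul_cancel Q) fun P _ => ?_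
        rw [Pauli.mul_mul_cancel]
    _ = ∑ P ∈ productGroup W, ∑ Q ∈ productGroup W, pDist ψ Q * pDist ψ (P.mul Q) := by
        simp_rw [Finset.mul_sum]
        exact Finset.sum_comm
    _ ≤ _ := by
        refine Finset.sum_le_sum fun P _ => ?_
        exact Finset.sum_le_univ_sum_of_nonneg fun Q =>
          mul_nonneg (pDist_nonneg _ _) (pDist_nonneg _ _)

/-- Bell difference sampling hits the stabilizer group of a state of fidelity `F` with probability
at least `F ^ 4`. -/
theorem fidelity_pow_four_le {n : ℕ} (ψ : PureState n) (W : Fin n → Axis) (s : Fin n → Bool) :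
    fidelity (basisState W s) ψ ^ 4 ≤ ∑ P ∈ productGroup W, qDist ψ P := by
  refine le_trans ?_ (sq_sum_pDist_le_sum_qDist ψ W)
  have e : fidelity (basisState W s) ψ ^ 4 = (fidelity (basisState W s) ψ ^ 2) ^ 2 := by ring
  rw [e]
  exact pow_le_pow_left₀ (sq_nonneg _) (fidelity_sq_le_sum_pDist ψ W s) 2

theorem exists_basisState {n : ℕ} (φ : StabProd n) : ∃ W s, basisState W s = φ := by
  have h : ∀ a : Stab1, ∃ (W : Axis) (s : Bool), W.eigenstate s = a := by
    intro a
    cases a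
    exacts [⟨.Z, false, rfl⟩, ⟨.Z, true, rfl⟩, ⟨.X, false, rfl⟩, ⟨.X, true, rfl⟩,
      ⟨.Y, false, rfl⟩, ⟨.Y, true, rfl⟩]
  choose W s hs using fun i => h (φ i)
  exact ⟨W, s, funext hs⟩

/-! ### Biased coordinates of a distribution of large min-entropy -/

/-- A distribution on bit strings of small maximal probability has few biased coordinates. -/
theorem card_biased_le {n : ℕ} {r : (Fin n → Bool) → ℝ} (hr : ∀ x, 0 ≤ r x) (hr1 : ∑ x, r x = 1)
    {M : ℝ} (hM : ∀ x, r x ≤ M) {p : ℝ} (hp : 1 / 2 < p) (hp1 : p < 1) (B : Finset (Fin n))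
    (hB : ∀ i ∈ B, p ≤ ∑ x, if x i then r x else 0) :
    B.card * (Real.log 2 - Real.binEntropy p) ≤ n * Real.log 2 + Real.log M := by
  have hM0 : 0 < M := by
    by_contra h
    have : ∑ x, r x ≤ 0 := Finset.sum_nonpos fun x _ => (hM x).trans (not_lt.1 h)
    linarith
  -- The reference product distribution: bias p on the coordinates in `B`, uniform elsewhere.
  set v : Fin n → Bool → ℝ := fun i b => if i ∈ B then (if b then p else 1 - p) else 1 / 2 with hv
  have hv0 : ∀ i b, 0 < v i b := by
    intro i b
    simp only [hv]
    split_ifs <;> linarith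
  have hu1 : ∑ x : Fin n → Bool, ∏ i, v i (x i) = 1 := by
    rw [← Fintype.piFinset_univ, ← Finset.prod_univ_sum]
    refine Finset.prod_eq_one fun i _ => ?_
    simp only [hv, Fintype.sum_bool]
    split_ifs <;> norm_num at *
  -- Gibbs' inequality pointwise, from log z ≤ z − 1, with log r replaced by its upper bound log M.
  have hgibbs : ∀ x, r x * (∑ i, Real.log (v i (x i))) - r x * Real.log M ≤
      (∏ i, v i (x i)) - r x := by
    intro x
    have hu0 : 0 < ∏ i, v i (x i) := Finset.prod_pos fun i _ => hv0 i _
    rcases (hr x).eq_or_lt with h0 | h0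
    · rw [← h0]
      simpa using hu0.le
    · rw [← Real.log_prod fun i _ => (hv0 i _).ne']
      have h1 := Real.log_le_sub_one_of_pos (div_pos hu0 h0)
      rw [Real.log_div hu0.ne' h0.ne'] at h1
      have h2 := Real.log_le_log h0 (hM x)
      calc r x * Real.log (∏ i, v i (x i)) - r x * Real.log M
          ≤ r x * ((∏ i, v i (x i)) / r x - 1) := by
            rw [← mul_sub]
            exact mul_le_mul_of_nonneg_left (by linarith) h0.le
        _ = _ := by field_simp
  have hsum := Finset.sum_le_sum fun x (_ : x ∈ Finset.univ) => hgibbs x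
  rw [Finset.sum_sub_distrib, Finset.sum_sub_distrib, hu1, hr1, ← Finset.sum_mul, hr1] at hsum
  simp_rw [Finset.mul_sum] at hsum
  rw [Finset.sum_comm] at hsum
  have hcoord : ∀ i, (if i ∈ B then -Real.binEntropy p else -Real.log 2) ≤
      ∑ x, r x * Real.log (v i (x i)) := by
    intro i
    simp only [hv]
    split_ifs with hi
    · have hπ := hB i hi
      set π := ∑ x, if x i then r x else 0 with hπdef
      have e : ∀ x, r x * Real.log (if x i = true then p else 1 - p) =
          (if x i = true then r x else 0) * (Real.log p - Real.log (1 - p))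
            + r x * Real.log (1 - p) := by
        intro x
        split_ifs <;> ring
      simp_rw [e]
      rw [Finset.sum_add_distrib, ← Finset.sum_mul, ← Finset.sum_mul, hr1, ← hπdef,
        Real.binEntropy, Real.log_inv, Real.log_inv]
      -- The expected log-likelihood is affine in the true bias with slope log p − log(1 − p) ≥ 0,
      -- so it is at least its value −H(p) at bias p.
      have hlog : Real.log (1 - p) ≤ Real.log p :=
        Real.log_le_log (by linarith) (by linarith)
      nlinarith
    · rw [← Finset.sum_mul, hr1, one_div, Real.log_inv, one_mul]
  have htot := Finset.sum_le_sum fun i (_ : i ∈ Finset.univ) => hcoord i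
  have hcount : ∑ i, (if i ∈ B then -Real.binEntropy p else -Real.log 2) =
      B.card * (Real.log 2 - Real.binEntropy p) - n * Real.log 2 := by
    have e : ∀ i, (if i ∈ B then -Real.binEntropy p else -Real.log 2) =
        (if i ∈ B then Real.log 2 - Real.binEntropy p else 0) - Real.log 2 := by
      intro i
      split_ifs <;> ring
    simp_rw [e]
    rw [Finset.sum_sub_distrib, Finset.sum_ite_mem]
    simp [mul_sub]
  rw [hcount] at htot
  linarith

/-! ### Covering by a fixed number of samples from a subset -/

section Covering

variable {α ι : Type} {w : α → ℝ}

theorem sum_piFinset_prod {m : ℕ} (s : Fin m → Finset α) :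
    ∑ x ∈ Fintype.piFinset s, ∏ j, w (x j) = ∏ j, ∑ a ∈ s j, w a :=
  (Finset.prod_univ_sum s fun _ a => w a).symm

theorem sum_pow_card_eq_binomTail (m k : ℕ) (θ : ℝ) :
    (∑ J : Finset (Fin m), if k ≤ J.card then θ ^ J.card * (1 - θ) ^ (m - J.card) else 0) =
      binomTail m k θ := by
  have h := Finset.sum_powerset_apply_card (x := (Finset.univ : Finset (Fin m)))
    fun j => if k ≤ j then θ ^ j * (1 - θ) ^ (m - j) else 0
  rw [Finset.powerset_univ, Finset.card_univ, Fintype.card_fin] at h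
  rw [h, binomTail, Finset.range_eq_Ico]
  have hsub : Finset.Ico k (m + 1) ⊆ Finset.Ico 0 (m + 1) :=
    Finset.Ico_subset_Ico (Nat.zero_le k) le_rfl
  rw [← Finset.sum_subset hsub]
  · refine Finset.sum_congr rfl fun j hj => ?_
    rw [if_pos (Finset.mem_Ico.1 hj).1, nsmul_eq_mul, mul_assoc]
  · intro j hj hj'
    rw [Finset.mem_Ico] at hj hj'
    rw [if_neg (by omega), smul_zero]

open Classical in
/-- Among `m` samples there are, with good probability, `k` samples from `A` that avoid each of a
family of small sets at least once. -/
theorem half_binomTail_le_piExp [Fintype α] [DecidableEq α] (hw : ∀ a, 0 ≤ w a) (h1 : ∑ a, w a = 1) {A : Finset α}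
    {G : Finset ι} {N : ι → Finset α} {p : ℝ}
    (hNp : ∀ i ∈ G, ∑ a ∈ N i, w a ≤ p * ∑ a ∈ A, w a) {k m : ℕ}
    (hG : G.card * p ^ k ≤ 1 / 2) :
    1 / 2 * binomTail m k (∑ a ∈ A, w a) ≤ piExp w m fun x =>
      if ∃ C : Finset (Fin m), C.card = k ∧ (∀ j ∈ C, x j ∈ A) ∧
        ∀ i ∈ G, ∃ j ∈ C, x j ∉ N i then 1 else 0 := by
  set θ := ∑ a ∈ A, w a with hθ
  have hcompl : ∑ a ∈ Aᶜ, w a = 1 - θ := by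
    rw [← h1, ← Finset.sum_add_sum_compl A w]
    ring
  have hθ0 : 0 ≤ θ := Finset.sum_nonneg fun a _ => hw a
  have hθ1 : 0 ≤ 1 - θ := by
    rw [← hcompl]
    exact Finset.sum_nonneg fun a _ => hw a
  have hprod0 : ∀ x : Fin m → α, 0 ≤ ∏ j, w (x j) := fun x =>
    Finset.prod_nonneg fun j _ => hw (x j)
  -- The sample space is split by the set of positions that hit `A`. Each fibre is a box, so the
  -- weights factor over positions.
  set pat : (Fin m → α) → Finset (Fin m) := fun x => Finset.univ.filter fun j => x j ∈ A with hpat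
  set box : Finset (Fin m) → Finset (Fin m → α) := fun J =>
    Fintype.piFinset fun j => if j ∈ J then A else Aᶜ with hbox
  have hfib : ∀ J, (Finset.univ.filter fun x => pat x = J) = box J := by
    intro J
    ext x
    simp only [hpat, hbox, Finset.mem_filter, Finset.mem_univ, true_and, Fintype.mem_piFinset,
      Finset.ext_iff]
    refine forall_congr' fun j => ?_
    by_cases hj : j ∈ J <;> simp [hj]
  have hmass : ∀ J : Finset (Fin m), ∏ j, (if j ∈ J then θ else 1 - θ) =
      θ ^ J.card * (1 - θ) ^ (m - J.card) := by
    intro J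
    rw [Finset.prod_ite, Finset.prod_const, Finset.prod_const, Finset.filter_mem_eq_inter,
      Finset.univ_inter]
    congr 2
    rw [Finset.filter_not, Finset.filter_mem_eq_inter, Finset.univ_inter,
      ← Finset.compl_eq_univ_sdiff, Finset.card_compl, Fintype.card_fin]
  have hboxsum : ∀ J, ∑ x ∈ box J, ∏ j, w (x j) = θ ^ J.card * (1 - θ) ^ (m - J.card) := by
    intro J
    rw [hbox, sum_piFinset_prod, ← hmass]
    refine Finset.prod_congr rfl fun j _ => ?_
    split_ifs
    · rfl
    · exact hcompl
  rw [← sum_pow_card_eq_binomTail, Finset.mul_sum]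
  unfold piExp
  rw [← Finset.sum_fiberwise (Finset.univ : Finset (Fin m → α)) pat]
  refine Finset.sum_le_sum fun J _ => ?_
  rw [hfib]
  split_ifs with hJ
  swap
  · rw [mul_zero]
    refine Finset.sum_nonneg fun x _ => mul_nonneg (hprod0 x) ?_
    dsimp only
    split_ifs <;> norm_num
  -- The choice of `C` depends on the pattern `J` only, not on the samples, so the union bound runs
  -- over `G` alone.
  obtain ⟨C, hCJ, hCk⟩ := Finset.exists_subset_card_eq hJ
  set WJ := θ ^ J.card * (1 - θ) ^ (m - J.card) with hWJ
  have hWJ0 : 0 ≤ WJ := by positivity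
  have hmiss : ∀ i ∈ G, (∑ x ∈ box J, (∏ j, w (x j)) *
      (if ∀ j ∈ C, x j ∈ N i then (1 : ℝ) else 0)) ≤ p ^ k * WJ := by
    intro i hi
    -- Missing `i` replaces `A` by `N i` at the k positions of `C`, each at the cost of a factor p.
    have hsub : (box J).filter (fun x => ∀ j ∈ C, x j ∈ N i) ⊆
        Fintype.piFinset fun j => if j ∈ C then N i else if j ∈ J then A else Aᶜ := by
      intro x hx
      rw [Finset.mem_filter, hbox, Fintype.mem_piFinset] at hx
      rw [Fintype.mem_piFinset]
      intro j
      split_ifs with hj1 hj2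
      · exact hx.2 j hj1
      · simpa [hj2] using hx.1 j
      · simpa [hj2] using hx.1 j
    simp_rw [mul_ite, mul_one, mul_zero]
    rw [← Finset.sum_filter]
    refine (Finset.sum_le_sum_of_subset_of_nonneg hsub fun x _ _ => hprod0 x).trans ?_
    have hpk : p ^ k = ∏ j : Fin m, if j ∈ C then p else 1 := by
      rw [Finset.prod_ite_mem, Finset.univ_inter, Finset.prod_const, hCk]
    rw [sum_piFinset_prod, hWJ, ← hmass, hpk, ← Finset.prod_mul_distrib]
    refine Finset.prod_le_prod (fun j _ => Finset.sum_nonneg fun a _ => hw a) fun j _ => ?_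
    by_cases hj : j ∈ C
    · simpa [hj, hCJ hj] using hNp i hi
    · by_cases hj' : j ∈ J
      · simp [hj, hj', hθ]
      · simp [hj, hj', hcompl]
  have hpoint : ∀ x ∈ box J, (1 : ℝ) - ∑ i ∈ G, (if ∀ j ∈ C, x j ∈ N i then (1 : ℝ) else 0) ≤
      if ∃ C : Finset (Fin m), C.card = k ∧ (∀ j ∈ C, x j ∈ A) ∧
        ∀ i ∈ G, ∃ j ∈ C, x j ∉ N i then 1 else 0 := by
    intro x hx
    rw [hbox, Fintype.mem_piFinset] at hx
    have hnn : ∀ i ∈ G, (0 : ℝ) ≤ if ∀ j ∈ C, x j ∈ N i then (1 : ℝ) else 0 := fun i _ => by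
      split_ifs <;> norm_num
    split_ifs with h
    · linarith [Finset.sum_nonneg hnn]
    · have : ∃ i ∈ G, ∀ j ∈ C, x j ∈ N i := by
        by_contra hcon
        push Not at hcon
        exact h ⟨C, hCk, fun j hj => by simpa [hCJ hj] using hx j, hcon⟩
      obtain ⟨i, hi, hij⟩ := this
      have h2 := Finset.single_le_sum hnn hi
      rw [if_pos hij] at h2
      linarith
  calc 1 / 2 * WJ ≤ WJ - G.card * p ^ k * WJ := by nlinarith
    _ = WJ - ∑ i ∈ G, p ^ k * WJ := by rw [Finset.sum_const, nsmul_eq_mul, mul_assoc]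
    _ ≤ WJ - ∑ i ∈ G, ∑ x ∈ box J, (∏ j, w (x j)) *
          (if ∀ j ∈ C, x j ∈ N i then (1 : ℝ) else 0) :=
        sub_le_sub_left (Finset.sum_le_sum hmiss) _
    _ = ∑ x ∈ box J, (∏ j, w (x j)) *
          (1 - ∑ i ∈ G, (if ∀ j ∈ C, x j ∈ N i then (1 : ℝ) else 0)) := by
        simp_rw [mul_sub, mul_one, Finset.mul_sum]
        rw [Finset.sum_sub_distrib, hboxsum, Finset.sum_comm]
    _ ≤ _ := Finset.sum_le_sum fun x hx => mul_le_mul_of_nonneg_left (hpoint x hx) (hprod0 x)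

end Covering

/-! ### Parameters -/

theorem one_le_cliqueSize {n : ℕ} (hn : 1 ≤ n) {p : ℝ} (hp : 1 / 2 < p) (hp1 : p < 1) :
    1 ≤ cliqueSize n p := by
  have hn' : (1 : ℝ) ≤ n := by exact_mod_cast hn
  refine Nat.ceil_pos.2 ?_
  refine Real.logb_pos_of_base_lt_one (by linarith) hp1 (by positivity) ?_
  rw [div_lt_one (by positivity)]
  linarith

theorem mul_pow_cliqueSize_le {n : ℕ} (hn : 1 ≤ n) {p : ℝ} (hp : 1 / 2 < p) (hp1 : p < 1) :
    n * p ^ cliqueSize n p ≤ 1 / 2 := by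
  have hn' : (1 : ℝ) ≤ n := by exact_mod_cast hn
  have hp0 : 0 < p := by linarith
  have h : p ^ cliqueSize n p ≤ 1 / (2 * n) := by
    rw [← Real.rpow_natCast]
    refine (Real.rpow_le_rpow_of_exponent_ge hp0 hp1.le (Nat.le_ceil _)).trans (le_of_eq ?_)
    exact Real.rpow_logb hp0 hp1.ne (by positivity)
  calc n * p ^ cliqueSize n p ≤ n * (1 / (2 * n)) := by gcongr
    _ = 1 / 2 := by field_simp

theorem cliqueSize_le_mClique_mul {n : ℕ} {τ p : ℝ} (hτ : 0 < τ) :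
    (cliqueSize n p : ℝ) + 1 ≤ mClique n τ p * τ ^ 4 := by
  have h := Nat.le_ceil ((1 / τ ^ 4) * ((cliqueSize n p : ℝ) + 1))
  calc (cliqueSize n p : ℝ) + 1 = (1 / τ ^ 4) * ((cliqueSize n p : ℝ) + 1) * τ ^ 4 := by
        field_simp
    _ ≤ _ := by unfold mClique; gcongr

theorem binEntropy_lt_log_two_of_half_lt {p : ℝ} (hp : 1 / 2 < p) :
    Real.binEntropy p < Real.log 2 :=
  Real.binEntropy_lt_log_two.2 (by rw [← one_div]; exact hp.ne')

/-- Passing to natural logarithms, t equals −4 log τ / (log 2 − H(p)) with H in nats; the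
denominator is positive since p > 1/2. -/
theorem le_tParam {τ p b : ℝ} (hp : 1 / 2 < p)
    (hb : b * (Real.log 2 - Real.binEntropy p) ≤ -(4 * Real.log τ)) : b ≤ tParam τ p := by
  have h := binEntropy_lt_log_two_of_half_lt hp
  have h2 : 0 < Real.log 2 := Real.log_pos (by norm_num)
  have e : tParam τ p = -(4 * Real.log τ) / (Real.log 2 - Real.binEntropy p) := by
    have h3 : Real.log 2 - Real.binEntropy p ≠ 0 := by linarith
    have h4 : 1 - Real.binEntropy p / Real.log 2 ≠ 0 := by
      rw [one_sub_div h2.ne']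
      exact div_ne_zero h3 h2.ne'
    unfold tParam binEntropy2
    rw [Real.logb, one_div, Real.log_inv, div_eq_div_iff h4 h3]
    field_simp
  rw [e, le_div_iff₀ (by linarith)]
  exact hb

/-! ### Local spans and their extensions -/

/-- There are `2 ^ (n - |B|)` bit strings that are `true` on `B`. -/
theorem card_true_on {n : ℕ} (B : Finset (Fin n)) :
    (Finset.univ.filter fun b : Fin n → Bool => ∀ i ∈ B, b i = true).card = 2 ^ (n - B.card) := by
  have e : (Finset.univ.filter fun b : Fin n → Bool => ∀ i ∈ B, b i = true) =
      Fintype.piFinset fun i => if i ∈ B then {true} else Finset.univ := by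
    ext b
    simp only [Finset.mem_filter, Finset.mem_univ, true_and, Fintype.mem_piFinset]
    refine forall_congr' fun i => ?_
    by_cases hi : i ∈ B <;> simp [hi]
  rw [e, Fintype.card_piFinset]
  simp_rw [apply_ite Finset.card]
  rw [Finset.prod_ite, Finset.filter_not, Finset.filter_mem_eq_inter, Finset.univ_inter,
    ← Finset.compl_eq_univ_sdiff]
  simp [Finset.card_compl]

theorem mem_localSpan {n : ℕ} {A : Finset (Pauli n)} {Q : Pauli n} :
    Q ∈ localSpan A ↔ ∀ i, Q i = Pauli1.I ∨ ∃ P ∈ A, Q i = P i := by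
  simp [localSpan]

theorem localSpan_subset_productGroup {n : ℕ} {A : Finset (Pauli n)} {W : Fin n → Axis}
    (h : A ⊆ productGroup W) : localSpan A ⊆ productGroup W := by
  intro Q hQ
  rw [mem_localSpan] at hQ
  rw [mem_productGroup]
  intro i
  rcases hQ i with h1 | ⟨P, hP, h1⟩
  · exact Or.inl h1
  · rw [h1]
    exact mem_productGroup.1 (h hP) i

/-- If the set `A` of elements of a product group is nontrivial on every qubit outside `B`, then
its local span has at least `2 ^ (n - |B|)` elements. -/
theorem le_logb_card_localSpan {n : ℕ} {A : Finset (Pauli n)} {W : Fin n → Axis}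
    (h : A ⊆ productGroup W) {B : Finset (Fin n)} (hB : ∀ i, i ∉ B → ∃ P ∈ A, P i ≠ Pauli1.I) :
    (n : ℝ) - B.card ≤ Real.logb 2 ((localSpan A).card : ℝ) := by
  -- Every group element that is trivial on `B` lies in the span: outside `B` its only possible
  -- nontrivial factor already occurs in `A`.
  have hsub : (Finset.univ.filter fun b : Fin n → Bool => ∀ i ∈ B, b i = true).image
      (productElem W) ⊆ localSpan A := by
    intro Q hQ
    rw [Finset.mem_image] at hQ
    obtain ⟨b, hb, rfl⟩ := hQ
    rw [Finset.mem_filter] at hb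
    rw [mem_localSpan]
    intro i
    rw [productElem_eq_I]
    by_cases hi : b i = true
    · exact Or.inl hi
    · right
      obtain ⟨P, hP, hPi⟩ := hB i fun hiB => hi (hb.2 i hiB)
      refine ⟨P, hP, ?_⟩
      rcases mem_productGroup.1 (h hP) i with h1 | h1
      · exact absurd h1 hPi
      · rw [h1]
        simp [productElem, hi]
  have hcard := Finset.card_le_card hsub
  rw [Finset.card_image_of_injective _ (productElem_injective W), card_true_on] at hcard
  have hBn : B.card ≤ n := by simpa using Finset.card_le_univ B
  have hcard' : (2 : ℝ) ^ (n - B.card) ≤ ((localSpan A).card : ℝ) := by exact_mod_cast hcard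
  rw [Real.le_logb_iff_rpow_le (by norm_num) (lt_of_lt_of_le (by positivity) hcard'),
    ← Nat.cast_sub hBn, Real.rpow_natCast]
  exact hcard'

/-- A set of Pauli strings with at least `2 ^ (n - t)` elements extends to at most `3 ^ t`
stabilizer product groups. -/
theorem card_extensions_le {n : ℕ} {S : Finset (Pauli n)} {t : ℝ}
    (h : (n : ℝ) - t ≤ Real.logb 2 (S.card : ℝ)) : ((extensions S).card : ℝ) ≤ 3 ^ t := by
  classical
  rcases (extensions S).eq_empty_or_nonempty with h0 | ⟨W, hW⟩
  · rw [h0]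
    simpa using Real.rpow_nonneg (by norm_num : (0 : ℝ) ≤ 3) t
  have mem_ext : ∀ W, W ∈ extensions S ↔ S ⊆ productGroup W := fun W => by simp [extensions]
  rw [mem_ext] at hW
  -- On `D` an element of `S` forces the axis; elsewhere three choices remain. Since `S` has at most
  -- 2^|D| elements, n − |D| ≤ t.
  set D : Finset (Fin n) := Finset.univ.filter fun i => ∃ P ∈ S, P i ≠ Pauli1.I with hD
  have hDn : D.card ≤ n := by simpa using Finset.card_le_univ D
  have hS : S.card ≤ 2 ^ D.card := by
    have hsub : S ⊆ (Finset.univ.filter fun b : Fin n → Bool => ∀ i ∈ Dᶜ, b i = true).image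
        (productElem W) := by
      intro P hP
      obtain ⟨b, rfl⟩ := exists_productElem (hW hP)
      refine Finset.mem_image_of_mem _ (Finset.mem_filter.2 ⟨Finset.mem_univ _, fun i hi => ?_⟩)
      rw [← productElem_eq_I W b i]
      by_contra hne
      exact Finset.mem_compl.1 hi (Finset.mem_filter.2 ⟨Finset.mem_univ _, _, hP, hne⟩)
    have := (Finset.card_le_card hsub).trans Finset.card_image_le
    rwa [card_true_on, Finset.card_compl, Fintype.card_fin, Nat.sub_sub_self hDn] at this
  have hE : (extensions S).card ≤ 3 ^ (n - D.card) := by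
    have hsub : extensions S ⊆
        Fintype.piFinset fun i => if i ∈ D then {W i} else Finset.univ := by
      intro W' hW'
      rw [mem_ext] at hW'
      rw [Fintype.mem_piFinset]
      intro i
      split_ifs with hi
      · obtain ⟨P, hP, hPi⟩ := (Finset.mem_filter.1 hi).2
        have h1 := (mem_productGroup.1 (hW hP) i).resolve_left hPi
        have h2 := (mem_productGroup.1 (hW' hP) i).resolve_left hPi
        have hinj : ∀ a b : Axis, a.toPauli1 = b.toPauli1 → a = b := by decide
        exact Finset.mem_singleton.2 (hinj _ _ (h2.symm.trans h1))
      · exact Finset.mem_univ _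
    refine (Finset.card_le_card hsub).trans (le_of_eq ?_)
    have h3 : Fintype.card Axis = 3 := rfl
    rw [Fintype.card_piFinset]
    simp_rw [apply_ite Finset.card]
    rw [Finset.prod_ite, Finset.filter_not, Finset.filter_mem_eq_inter, Finset.univ_inter,
      ← Finset.compl_eq_univ_sdiff]
    simp [Finset.card_compl, h3]
  have hlog : Real.logb 2 (S.card : ℝ) ≤ D.card := by
    -- For empty `S` the convention `Real.logb 2 0 = 0` keeps the bound valid.
    rcases Nat.eq_zero_or_pos S.card with h0 | h0
    · simp [h0]
    · rw [Real.logb_le_iff_le_rpow (by norm_num) (by exact_mod_cast h0), Real.rpow_natCast]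
      exact_mod_cast hS
  calc ((extensions S).card : ℝ) ≤ (3 : ℝ) ^ (n - D.card) := by exact_mod_cast hE
    _ = (3 : ℝ) ^ ((n - D.card : ℕ) : ℝ) := (Real.rpow_natCast _ _).symm
    _ ≤ 3 ^ t := by
        refine Real.rpow_le_rpow_of_exponent_le (by norm_num) ?_
        rw [Nat.cast_sub hDn]
        linarith

/-! ### Bell difference samples that generate most of a stabilizer product group -/

/-- The samples `V` contain `k` elements of `productGroup W` whose local span has index at most
`2 ^ t`. -/
def HasSpanningClique {n m : ℕ} (W : Fin n → Axis) (k : ℕ) (t : ℝ) (V : Fin m → Pauli n) : Prop :=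
  ∃ C : Finset (Fin m), C.card = k ∧ (∀ j ∈ C, V j ∈ productGroup W) ∧
    (n : ℝ) - t ≤ Real.logb 2 ((localSpan (C.image V)).card : ℝ)

-- Two factors 1/2: enough samples fall into the group, and given this, k of them are jointly
-- nontrivial on every qubit outside the few biased ones.
open Classical in
theorem quarter_le_piExp_hasSpanningClique {n : ℕ} (hn : 1 ≤ n) (ψ : PureState n) {τ p : ℝ}
    (hτ : 0 < τ) (hp : 1 / 2 < p) (hp1 : p < 1) (W : Fin n → Axis) (s : Fin n → Bool)
    (hF : τ ≤ fidelity (basisState W s) ψ) :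
    1 / 4 ≤ piExp (qDist ψ) (mClique n τ p) fun V =>
      if HasSpanningClique W (cliqueSize n p) (tParam τ p) V then 1 else 0 := by
  set θ := ∑ P ∈ productGroup W, qDist ψ P with hθ
  have hτθ : τ ^ 4 ≤ θ := (pow_le_pow_left₀ hτ.le hF 4).trans (fidelity_pow_four_le ψ W s)
  have hθ0 : 0 < θ := lt_of_lt_of_le (by positivity) hτθ
  have hθ1 : θ ≤ 1 := by
    rw [← sum_qDist ψ]
    exact Finset.sum_le_univ_sum_of_nonneg fun P => qDist_nonneg ψ P
  set N : Fin n → Finset (Pauli n) := fun i => (productGroup W).filter fun P => P i = Pauli1.I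
    with hN
  -- The strict inequality leaves the bound p·θ on the complement, as the covering argument needs.
  set B : Finset (Fin n) := Finset.univ.filter fun i => p * θ < ∑ P ∈ N i, qDist ψ P with hB
  have hBcard : (B.card : ℝ) ≤ tParam τ p := by
    refine le_tParam hp ?_
    have hr1 : ∑ b, qDist ψ (productElem W b) / θ = 1 := by
      rw [← Finset.sum_div, ← sum_productGroup, ← hθ, div_self hθ0.ne']
    -- With M = 2⁻ⁿ/θ the right side n log 2 + log M becomes −log θ, which is at most −4 log τ.
    refine (card_biased_le (r := fun b => qDist ψ (productElem W b) / θ)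
      (fun b => div_nonneg (qDist_nonneg _ _) hθ0.le) hr1 (M := 1 / 2 ^ n / θ)
      (fun b => by have := qDist_le ψ (productElem W b); gcongr) hp hp1 B fun i hi => ?_).trans ?_
    · have h1 := (Finset.mem_filter.1 hi).2
      rw [hN, Finset.sum_filter, sum_productGroup] at h1
      simp_rw [productElem_eq_I] at h1
      have h2 : ∑ b : Fin n → Bool, (if b i = true then qDist ψ (productElem W b) / θ else 0) =
          (∑ b : Fin n → Bool, if b i = true then qDist ψ (productElem W b) else 0) / θ := by
        rw [Finset.sum_div]
        exact Finset.sum_congr rfl fun b _ => by split_ifs <;> simp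
      rw [h2, le_div_iff₀ hθ0]
      exact h1.le
    · rw [Real.log_div (by positivity) hθ0.ne', one_div, Real.log_inv, Real.log_pow]
      have := Real.log_le_log (by positivity) hτθ
      rw [Real.log_pow] at this
      push_cast at this
      linarith
  have hmean := cliqueSize_le_mClique_mul (n := n) (p := p) hτ
  have htail : 1 / 2 ≤ binomTail (mClique n τ p) (cliqueSize n p) θ := by
    refine half_le_binomTail (one_le_cliqueSize hn hp hp1) hθ0 hθ1 ?_
    have : (mClique n τ p : ℝ) * τ ^ 4 ≤ mClique n τ p * θ := by gcongr
    linarith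
  have hG : ((Bᶜ).card : ℝ) * p ^ cliqueSize n p ≤ 1 / 2 := by
    refine le_trans ?_ (mul_pow_cliqueSize_le hn hp hp1)
    have : (Bᶜ).card ≤ n := by simpa using Finset.card_le_univ Bᶜ
    have hp0 : 0 < p := by linarith
    gcongr
  have hcover := half_binomTail_le_piExp (w := qDist ψ) (qDist_nonneg ψ) (sum_qDist ψ)
    (A := productGroup W) (G := Bᶜ) (N := N) (p := p) (k := cliqueSize n p) (m := mClique n τ p)
    (fun i hi => by
      rw [Finset.mem_compl, hB, Finset.mem_filter, not_and] at hi
      exact not_lt.1 (hi (Finset.mem_univ i))) hG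
  refine le_trans (by linarith) (hcover.trans (piExp_mono (qDist_nonneg ψ) fun V => ?_))
  split_ifs with h1 h2 h2
  · exact le_rfl
  · obtain ⟨C, hCk, hCA, hCN⟩ := h1
    refine absurd ⟨C, hCk, hCA, le_trans (by linarith) (le_logb_card_localSpan (W := W) (B := B)
      ?_ ?_)⟩ h2
    · intro P hP
      obtain ⟨j, hj, rfl⟩ := Finset.mem_image.1 hP
      exact hCA j hj
    · intro i hi
      obtain ⟨j, hj, hjN⟩ := hCN i (Finset.mem_compl.2 hi)
      refine ⟨V j, Finset.mem_image_of_mem V hj, fun hI => hjN ?_⟩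
      exact Finset.mem_filter.2 ⟨hCA j hj, hI⟩
  · norm_num
  · exact le_rfl

/-! ### Probabilities of events of randomized programs -/

section PMF

variable {α β : Type}

theorem toOuterMeasure_univ (q : PMF α) : q.toOuterMeasure Set.univ = 1 :=
  (q.toOuterMeasure_apply_eq_one_iff _).2 (Set.subset_univ _)

theorem toOuterMeasure_le_one (q : PMF α) (s : Set α) : q.toOuterMeasure s ≤ 1 := by
  rw [← toOuterMeasure_univ q]
  exact q.toOuterMeasure.mono (Set.subset_univ s)

theorem bind_toOuterMeasure_le_const {q : PMF α} {f : α → PMF β} {s : Set β} {c : ENNReal}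
    (h : ∀ a, (f a).toOuterMeasure s ≤ c) : (q.bind f).toOuterMeasure s ≤ c := by
  rw [PMF.toOuterMeasure_bind_apply]
  calc ∑' a, q a * (f a).toOuterMeasure s ≤ ∑' a, q a * c :=
        ENNReal.tsum_le_tsum fun a => mul_le_mul_right (h a) _
    _ = c := by rw [ENNReal.tsum_mul_right, q.tsum_coe, one_mul]

theorem bind_toOuterMeasure_le {q : PMF α} {f : α → PMF β} {s : Set β} {t : Set α}
    (h : ∀ a, a ∉ t → (f a).toOuterMeasure s = 0) :
    (q.bind f).toOuterMeasure s ≤ q.toOuterMeasure t := by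
  rw [PMF.toOuterMeasure_bind_apply, PMF.toOuterMeasure_apply]
  refine ENNReal.tsum_le_tsum fun a => ?_
  by_cases ha : a ∈ t
  · rw [Set.indicator_of_mem ha]
    exact mul_le_of_le_one_right' (toOuterMeasure_le_one _ _)
  · rw [h a ha, mul_zero]
    exact zero_le

theorem iid_apply [Fintype α] (q : PMF α) (m : ℕ) (x : Fin m → α) :
    iid q m x = ∏ i, q (x i) := by
  classical
  induction m with
  | zero =>
    rw [iid, PMF.pure_apply, if_pos (Subsingleton.elim _ _)]
    simp
  | succ m ih =>
    rw [iid, PMF.bind_apply, tsum_fintype, Finset.sum_eq_single (x 0)]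
    · rw [PMF.bind_apply, tsum_fintype, Finset.sum_eq_single (Fin.tail x)]
      · rw [PMF.pure_apply, if_pos (Fin.cons_self_tail x).symm, mul_one, ih, Fin.prod_univ_succ]
        rfl
      · intro y _ hy
        rw [PMF.pure_apply, if_neg, mul_zero]
        intro h
        exact hy (by rw [h, Fin.tail_cons])
      · simp
    · intro a _ ha
      rw [PMF.bind_apply, tsum_fintype, Finset.sum_eq_zero, mul_zero]
      intro y _
      rw [PMF.pure_apply, if_neg, mul_zero]
      intro h
      exact ha (by rw [h, Fin.cons_zero])
    · simp

open Classical in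
theorem iid_toOuterMeasure [Fintype α] {q : PMF α} {w : α → ℝ} (hw : ∀ a, 0 ≤ w a)
    (hq : ∀ a, q a = ENNReal.ofReal (w a)) (m : ℕ) (s : Set (Fin m → α)) :
    (iid q m).toOuterMeasure s =
      ENNReal.ofReal (piExp w m fun x => if x ∈ s then 1 else 0) := by
  have hp : ∀ x : Fin m → α, 0 ≤ ∏ i, w (x i) := fun x => Finset.prod_nonneg fun i _ => hw (x i)
  rw [PMF.toOuterMeasure_apply_fintype, piExp, ENNReal.ofReal_sum_of_nonneg fun x _ =>
    mul_nonneg (hp x) (by split_ifs <;> norm_num)]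
  refine Finset.sum_congr rfl fun x _ => ?_
  by_cases hx : x ∈ s
  · rw [Set.indicator_of_mem hx, if_pos hx, mul_one, iid_apply,
      ENNReal.ofReal_prod_of_nonneg fun i _ => hw (x i)]
    exact Finset.prod_congr rfl fun i _ => hq (x i)
  · rw [Set.indicator_of_notMem hx, if_neg hx, mul_zero, ENNReal.ofReal_zero]

theorem forEach_cons_toOuterMeasure (body : α → PMF (List β)) (a : α) (l : List α)
    (s : Set (List β)) :
    (forEach body (a :: l)).toOuterMeasure s =
      ∑' r, body a r * (forEach body l).toOuterMeasure ((fun r' => r ++ r') ⁻¹' s) := by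
  rw [forEach, PMF.toOuterMeasure_bind_apply]
  refine tsum_congr fun r => ?_
  rw [← PMF.toOuterMeasure_map_apply]
  rfl

/-- The union bound for a loop. -/
theorem forEach_exists_le {body : α → PMF (List β)} {l : List α} {P : β → Prop} {c : ENNReal}
    (h : ∀ a ∈ l, (body a).toOuterMeasure {L | ∃ r ∈ L, P r} ≤ c) :
    (forEach body l).toOuterMeasure {L | ∃ r ∈ L, P r} ≤ l.length * c := by
  induction l with
  | nil => simp [forEach, PMF.toOuterMeasure_pure_apply]
  | cons a l ih =>
    set S : Set (List β) := {L | ∃ r ∈ L, P r} with hS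
    have ih' := ih fun b hb => h b (List.mem_cons_of_mem a hb)
    rw [forEach_cons_toOuterMeasure]
    calc ∑' r, body a r * (forEach body l).toOuterMeasure ((fun r' => r ++ r') ⁻¹' S)
        ≤ ∑' r, (S.indicator (body a) r + body a r * (l.length * c)) := by
          refine ENNReal.tsum_le_tsum fun r => ?_
          by_cases hr : r ∈ S
          · rw [Set.indicator_of_mem hr]
            exact (mul_le_of_le_one_right' (toOuterMeasure_le_one _ _)).trans le_self_add
          · rw [Set.indicator_of_notMem hr, zero_add]
            refine mul_le_mul_right (le_trans ((forEach body l).toOuterMeasure.mono ?_) ih') _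
            rintro r' ⟨x, hx, hPx⟩
            rcases List.mem_append.1 hx with hx | hx
            · exact absurd ⟨x, hx, hPx⟩ hr
            · exact ⟨x, hx, hPx⟩
      _ = (body a).toOuterMeasure S + l.length * c := by
          rw [ENNReal.tsum_add, ENNReal.tsum_mul_right, (body a).tsum_coe, one_mul,
            PMF.toOuterMeasure_apply]
      _ ≤ c + l.length * c := by
          gcongr
          exact h a List.mem_cons_self
      _ = _ := by
          rw [List.length_cons]
          push_cast
          ring

/-- The iterations of a loop are independent. -/
theorem forEach_forall_eq (body : α → PMF (List β)) (l : List α) (P : β → Prop) :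
    (forEach body l).toOuterMeasure {L | ∀ r ∈ L, P r} =
      (l.map fun a => (body a).toOuterMeasure {L | ∀ r ∈ L, P r}).prod := by
  induction l with
  | nil => simp [forEach, PMF.toOuterMeasure_pure_apply]
  | cons a l ih =>
    rw [forEach_cons_toOuterMeasure, List.map_cons, List.prod_cons, ← ih,
      PMF.toOuterMeasure_apply (body a), ← ENNReal.tsum_mul_right]
    refine tsum_congr fun r => ?_
    by_cases hr : r ∈ {L : List β | ∀ r ∈ L, P r}
    · rw [Set.indicator_of_mem hr]
      congr 2
      ext r'
      simp only [Set.mem_preimage, Set.mem_ofPred_eq, List.mem_append]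
      exact ⟨fun h x hx => h x (Or.inr hx), fun h x hx => hx.elim (hr x) (h x)⟩
    · rw [Set.indicator_of_notMem hr, zero_mul]
      have : (fun r' => r ++ r') ⁻¹' {L : List β | ∀ r ∈ L, P r} = ∅ := by
        ext r'
        simp only [Set.mem_preimage, Set.mem_ofPred_eq, List.mem_append, Set.mem_empty_iff_false,
          iff_false]
        exact fun h => hr fun x hx => h x (Or.inl hx)
      rw [this, MeasureTheory.measure_empty, mul_zero]

theorem forEach_forall_eq_zero {body : α → PMF (List β)} {l : List α} {P : β → Prop} {a : α}
    (ha : a ∈ l) (h : (body a).toOuterMeasure {L | ∀ r ∈ L, P r} = 0) :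
    (forEach body l).toOuterMeasure {L | ∀ r ∈ L, P r} = 0 := by
  rw [forEach_forall_eq]
  exact List.prod_eq_zero (List.mem_map.2 ⟨a, ha, h⟩)

end PMF

/-! ### Analysis of the algorithm -/

theorem estimateBasis_exists_dev_le {n : ℕ} (ψ : PureState n) {m : ℕ} {ε : ℝ} (hε : 0 < ε)
    (hm : 8 ≤ m * ε ^ 2) (W : Fin n → Axis) :
    (estimateBasis ψ m W).toOuterMeasure {L | ∃ r ∈ L, ε / 2 < |r.2 - fidelity r.1 ψ|} ≤
      ENNReal.ofReal (2 * Real.exp (-(m * ε ^ 2 / 8))) := by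
  classical
  rw [estimateBasis, PMF.toOuterMeasure_map_apply,
    iid_toOuterMeasure (w := fun s => fidelity (basisState W s) ψ)
      (fun s => fidelity_nonneg _ _) (fun s => rfl)]
  refine ENNReal.ofReal_le_ofReal ?_
  -- With deviation ε/2, the requirement 2 ≤ mη² is the hypothesis 8 ≤ mε².
  have h := piExp_exists_dev_le (w := fun s => fidelity (basisState W s) ψ)
    (fun s => fidelity_nonneg _ _) (sum_fidelity_basisState ψ W) (m := m) (η := ε / 2)
    (by linarith) (by linarith)
  have e : (m : ℝ) * (ε / 2) ^ 2 / 2 = m * ε ^ 2 / 8 := by ring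
  rw [e] at h
  refine le_trans (piExp_mono (fun s => fidelity_nonneg _ _) fun o => ?_) h
  split_ifs with h1 h2 h2
  · exact le_rfl
  · refine absurd ?_ h2
    obtain ⟨r, hr, hdev⟩ := h1
    obtain ⟨s, -, rfl⟩ := List.mem_map.1 hr
    refine ⟨s, ?_⟩
    convert hdev using 3
    unfold freq empirical
    congr!
  · norm_num
  · exact le_rfl

/-- All basis states are recorded, including those never observed, so measuring in the right basis
is enough. -/
theorem estimateBasis_forall_ne {n : ℕ} (ψ : PureState n) (m : ℕ) (W : Fin n → Axis)
    (s : Fin n → Bool) :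
    (estimateBasis ψ m W).toOuterMeasure {L | ∀ r ∈ L, r.1 ≠ basisState W s} = 0 := by
  rw [estimateBasis, PMF.toOuterMeasure_map_apply]
  convert MeasureTheory.measure_empty (μ := (iid (measureBasis ψ W) m).toOuterMeasure)
  ext o
  simp only [Set.mem_preimage, Set.mem_ofPred_eq, Set.mem_empty_iff_false, iff_false]
  intro h
  exact h (basisState W s, empirical o s)
    (List.mem_map.2 ⟨s, Finset.mem_toList.2 (Finset.mem_univ s), rfl⟩) rfl

/-- The union bound holds for every outcome of the Bell sampling: cliques are k-subsets of the
samples, and the size test caps the extensions of each span at 3ᵗ. -/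
theorem outerIteration_exists_dev_le {n : ℕ} (ψ : PureState n) {ε τ p δ : ℝ} (hε : 0 < ε)
    (hm : 8 ≤ mEst n ε τ p δ * ε ^ 2) :
    (outerIteration ψ ε τ p δ).toOuterMeasure {L | ∃ r ∈ L, ε / 2 < |r.2 - fidelity r.1 ψ|} ≤
      ((mClique n τ p).choose (cliqueSize n p) : ENNReal) * (ENNReal.ofReal (3 ^ tParam τ p) *
        ENNReal.ofReal (2 * Real.exp (-(mEst n ε τ p δ * ε ^ 2 / 8)))) := by
  classical
  refine bind_toOuterMeasure_le_const fun V => ?_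
  refine (forEach_exists_le (c := ENNReal.ofReal (3 ^ tParam τ p) *
    ENNReal.ofReal (2 * Real.exp (-(mEst n ε τ p δ * ε ^ 2 / 8)))) fun C _ => ?_).trans ?_
  · dsimp only
    split_ifs with hS
    · refine (forEach_exists_le fun W _ => estimateBasis_exists_dev_le ψ hε hm W).trans ?_
      rw [Finset.length_toList]
      refine mul_le_mul_left ?_ _
      rw [← ENNReal.ofReal_natCast]
      exact ENNReal.ofReal_le_ofReal (card_extensions_le hS)
    · simp [PMF.toOuterMeasure_pure_apply]
  · rw [Finset.length_toList]
    refine mul_le_mul_left ?_ _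
    have : ((sampleGraph V).cliqueFinset (cliqueSize n p)).card ≤
        (mClique n τ p).choose (cliqueSize n p) := by
      have hsub : (sampleGraph V).cliqueFinset (cliqueSize n p) ⊆
          Finset.powersetCard (cliqueSize n p) Finset.univ := fun C hC =>
        Finset.mem_powersetCard.2 ⟨Finset.subset_univ C,
          (SimpleGraph.mem_cliqueFinset_iff.1 hC).card_eq⟩
      simpa [Finset.card_powersetCard] using Finset.card_le_card hsub
    exact_mod_cast this

theorem localNoncomm_eq_zero {n : ℕ} {W : Fin n → Axis} {P Q : Pauli n}
    (hP : P ∈ productGroup W) (hQ : Q ∈ productGroup W) : localNoncomm P Q = 0 := by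
  rw [localNoncomm, Finset.card_eq_zero, Finset.filter_eq_empty_iff]
  intro i _
  have hI : Pauli1.I.mat = 1 := by
    simp [Pauli1.mat, Matrix.one_fin_two]
  rw [not_not]
  rcases mem_productGroup.1 hP i with h1 | h1 <;> rcases mem_productGroup.1 hQ i with h2 | h2 <;>
    rw [h1, h2] <;> simp [hI]

/-- A spanning set of samples inside the group is a clique that passes the size test, and the group
is one of its extensions. Hence a miss requires that no such set was drawn. -/
theorem outerIteration_forall_ne_le {n : ℕ} (hn : 1 ≤ n) (ψ : PureState n) {ε τ p δ : ℝ}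
    (hτ : 0 < τ) (hp : 1 / 2 < p) (hp1 : p < 1) (W : Fin n → Axis) (s : Fin n → Bool)
    (hF : τ ≤ fidelity (basisState W s) ψ) :
    (outerIteration ψ ε τ p δ).toOuterMeasure {L | ∀ r ∈ L, r.1 ≠ basisState W s} ≤
      ENNReal.ofReal (3 / 4) := by
  classical
  refine (bind_toOuterMeasure_le (t := {V | ¬ HasSpanningClique W (cliqueSize n p) (tParam τ p) V})
    fun V hV => ?_).trans ?_
  · rw [Set.mem_ofPred_eq, not_not] at hV
    obtain ⟨C, hCk, hCA, hCS⟩ := hV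
    have hclique : C ∈ (sampleGraph V).cliqueFinset (cliqueSize n p) := by
      rw [SimpleGraph.mem_cliqueFinset_iff, SimpleGraph.isNClique_iff]
      refine ⟨fun i hi j hj hij => ?_, hCk⟩
      rw [sampleGraph, SimpleGraph.fromRel_adj]
      exact ⟨hij, Or.inl (localNoncomm_eq_zero (hCA i hi) (hCA j hj))⟩
    refine forEach_forall_eq_zero (a := C) (Finset.mem_toList.2 (by convert hclique)) ?_
    dsimp only
    rw [if_pos (by convert hCS)]
    refine forEach_forall_eq_zero (a := W) (Finset.mem_toList.2 ?_)
      (estimateBasis_forall_ne ψ _ W s)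
    refine Finset.mem_filter.2 ⟨Finset.mem_univ _, localSpan_subset_productGroup fun P hP => ?_⟩
    obtain ⟨j, hj, rfl⟩ := Finset.mem_image.1 hP
    exact hCA j hj
  · rw [iid_toOuterMeasure (w := qDist ψ) (qDist_nonneg ψ) (fun P => rfl)]
    refine ENNReal.ofReal_le_ofReal ?_
    have h := quarter_le_piExp_hasSpanningClique hn ψ hτ hp hp1 W s hF
    have e : (piExp (qDist ψ) (mClique n τ p) fun V =>
        (if HasSpanningClique W (cliqueSize n p) (tParam τ p) V then (1 : ℝ) else 0) +
          if V ∈ {V | ¬ HasSpanningClique W (cliqueSize n p) (tParam τ p) V} then 1 else 0) = 1 := by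
      refine Eq.trans ?_ (piExp_const (sum_qDist ψ) (mClique n τ p) 1)
      congr 1
      funext V
      by_cases hV : HasSpanningClique W (cliqueSize n p) (tParam τ p) V <;> simp [hV]
    rw [piExp_add] at e
    refine le_trans (le_of_eq ?_) (sub_le_sub_left h 1 |>.trans (by norm_num))
    rw [← eq_sub_iff_add_eq'.2 e]
    congr!

theorem one_le_mOuter {δ : ℝ} (hδ : 0 < δ) (hδ1 : δ < 1) : 1 ≤ mOuter δ :=
  Nat.ceil_pos.2 (Real.logb_pos_of_base_lt_one (by norm_num) (by norm_num) (by linarith)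
    (by linarith))

theorem pow_mOuter_le {δ : ℝ} (hδ : 0 < δ) : (3 / 4 : ℝ) ^ mOuter δ ≤ δ / 2 := by
  rw [← Real.rpow_natCast]
  refine (Real.rpow_le_rpow_of_exponent_ge (by norm_num) (by norm_num) (Nat.le_ceil _)).trans
    (le_of_eq ?_)
  exact Real.rpow_logb (by norm_num) (by norm_num) (by linarith)

theorem tParam_nonneg {τ p : ℝ} (hτ : 0 < τ) (hτ1 : τ < 1) (hp : 1 / 2 < p) : 0 ≤ tParam τ p := by
  refine le_tParam hp ?_
  have := Real.log_neg hτ hτ1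
  linarith

theorem cliqueSize_le_mClique {n : ℕ} {τ p : ℝ} (hτ : 0 < τ) (hτ1 : τ < 1) :
    cliqueSize n p ≤ mClique n τ p := by
  have h := cliqueSize_le_mClique_mul (n := n) (p := p) hτ
  have h2 : (mClique n τ p : ℝ) * τ ^ 4 ≤ mClique n τ p :=
    mul_le_of_le_one_right (Nat.cast_nonneg _) (pow_le_one₀ hτ.le hτ1.le)
  have h3 : (cliqueSize n p : ℝ) ≤ mClique n τ p := by linarith
  exact_mod_cast h3

/-- The failure probability granted to a single basis measurement. -/
theorem mEst_spec {n : ℕ} {ε τ p δ : ℝ} (hε : 0 < ε) (hτ : 0 < τ) (hτ1 : τ < 1) (hp : 1 / 2 < p)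
    (hδ : 0 < δ) (hδ1 : δ < 1) :
    8 ≤ mEst n ε τ p δ * ε ^ 2 ∧
    (mOuter δ : ℝ) * (((mClique n τ p).choose (cliqueSize n p) : ℝ) * (3 ^ tParam τ p *
      (2 * Real.exp (-(mEst n ε τ p δ * ε ^ 2 / 8))))) ≤ δ / 2 := by
  set M : ℝ := (mOuter δ : ℝ) with hM
  set K : ℝ := ((mClique n τ p).choose (cliqueSize n p) : ℝ) with hK
  set T : ℝ := 3 ^ tParam τ p with hT
  have hM1 : 1 ≤ M := by rw [hM]; exact_mod_cast one_le_mOuter hδ hδ1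
  have hK1 : 1 ≤ K := by
    rw [hK]
    exact_mod_cast Nat.choose_pos (cliqueSize_le_mClique hτ hτ1)
  have hT1 : 1 ≤ T := Real.one_le_rpow (by norm_num) (tParam_nonneg hτ hτ1 hp)
  have hN1 : 1 ≤ M * K * T := one_le_mul_of_one_le_of_one_le
    (one_le_mul_of_one_le_of_one_le hM1 hK1) hT1
  set X : ℝ := 4 * M * K * T / δ with hX
  -- Since 4 > e, this yields log X ≥ 1 and hence 8 ≤ mε², the threshold of the concentration bound.
  have hX4 : 4 ≤ X := by
    rw [hX, le_div_iff₀ hδ]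
    nlinarith
  have hm : 8 * Real.log X ≤ mEst n ε τ p δ * ε ^ 2 := by
    have := Nat.le_ceil (8 * Real.log X / ε ^ 2)
    rw [div_le_iff₀ (by positivity)] at this
    exact this
  have hlog : 1 ≤ Real.log X := by
    rw [Real.le_log_iff_exp_le (by linarith)]
    linarith [Real.exp_one_lt_d9]
  refine ⟨by linarith, ?_⟩
  have hexp : Real.exp (-(mEst n ε τ p δ * ε ^ 2 / 8)) ≤ X⁻¹ := by
    rw [← Real.exp_log (by linarith : 0 < X), ← Real.exp_neg]
    refine Real.exp_le_exp.2 ?_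
    linarith
  calc M * (K * (T * (2 * Real.exp (-(mEst n ε τ p δ * ε ^ 2 / 8)))))
      ≤ M * (K * (T * (2 * X⁻¹))) := by gcongr
    _ = δ / 2 := by
      rw [hX]
      field_simp
      norm_num

/-- The best record has at least the fraction of any record of φ, and passing between fraction and
fidelity costs ε/2 on each side. Repeated records of a state do no harm, as all of them are
accurate. -/
theorem fidelity_bestRecord_ge {n : ℕ} {ψ : PureState n} {ε : ℝ} {L : List (StabProd n × ℝ)}
    (hdev : ∀ r ∈ L, |r.2 - fidelity r.1 ψ| ≤ ε / 2) {φ : StabProd n} (hφ : ∃ r ∈ L, r.1 = φ) :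
    fidelity φ ψ - ε ≤ fidelity (bestRecord L) ψ := by
  obtain ⟨r, hr, rfl⟩ := hφ
  have hne : L.argmax Prod.snd ≠ none := by
    rw [Ne, List.argmax_eq_none]
    exact List.ne_nil_of_mem hr
  obtain ⟨b, hb⟩ := Option.ne_none_iff_exists'.1 hne
  have hbest : bestRecord L = b.1 := by
    rw [bestRecord, hb]
  have hle := List.le_of_mem_argmax hr (Option.mem_def.2 hb)
  have h1 := abs_le.1 (hdev r hr)
  have h2 := abs_le.1 (hdev b (List.argmax_mem (Option.mem_def.2 hb)))
  rw [hbest]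
  linarith [h1.1, h2.2]

theorem le_stabProdApprox_of_le {n : ℕ} (hn : 1 ≤ n) (ψ : PureState n) {ε τ p δ : ℝ}
    (hε : 0 < ε) (hετ : ε ≤ τ) (hτ : τ < 1) (hp : 1 / 2 < p) (hp1 : p < 1)
    (hδ : 0 < δ) (hδ1 : δ < 1) (hF : τ ≤ stabProdFidelity ψ) :
    ENNReal.ofReal (1 - δ) ≤ (stabProdApprox ψ ε τ p δ).toOuterMeasure
      {φ | fidelity φ ψ ≥ stabProdFidelity ψ - ε} := by
  have hτ0 : 0 < τ := hε.trans_le hετ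
  obtain ⟨φ, -, hφ⟩ := Finset.exists_mem_eq_sup' (s := Finset.univ)
    ⟨fun _ : Fin n => Stab1.zero, Finset.mem_univ _⟩ fun φ : StabProd n => fidelity φ ψ
  obtain ⟨W, s, rfl⟩ := exists_basisState φ
  change stabProdFidelity ψ = _ at hφ
  rw [hφ] at hF ⊢
  obtain ⟨hm, hbudget⟩ := mEst_spec (n := n) (p := p) hε hτ0 hτ hp hδ hδ1
  rw [stabProdApprox, PMF.toOuterMeasure_map_apply]
  set D := forEach (fun _ : ℕ => outerIteration ψ ε τ p δ) (List.range (mOuter δ)) with hD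
  set dev : Set (List (StabProd n × ℝ)) := {L | ∃ r ∈ L, ε / 2 < |r.2 - fidelity r.1 ψ|} with hdev
  set miss : Set (List (StabProd n × ℝ)) := {L | ∀ r ∈ L, r.1 ≠ basisState W s} with hmiss
  set good := bestRecord ⁻¹' {φ | fidelity φ ψ ≥ fidelity (basisState W s) ψ - ε} with hgood
  have h1 : D.toOuterMeasure dev ≤ ENNReal.ofReal (δ / 2) := by
    refine (forEach_exists_le fun _ _ => outerIteration_exists_dev_le ψ hε hm).trans ?_
    refine le_trans (le_of_eq ?_) (ENNReal.ofReal_le_ofReal hbudget)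
    have hT : (0 : ℝ) ≤ 3 ^ tParam τ p := Real.rpow_nonneg (by norm_num) _
    rw [List.length_range, ENNReal.ofReal_mul (Nat.cast_nonneg _),
      ENNReal.ofReal_mul (Nat.cast_nonneg _), ENNReal.ofReal_mul hT, ENNReal.ofReal_natCast,
      ENNReal.ofReal_natCast]
  have h2 : D.toOuterMeasure miss ≤ ENNReal.ofReal (δ / 2) := by
    rw [hD, hmiss, forEach_forall_eq, List.map_const', List.prod_replicate, List.length_range]
    refine (pow_le_pow_left' (outerIteration_forall_ne_le hn ψ hτ0 hp hp1 W s hF) _).trans ?_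
    rw [← ENNReal.ofReal_pow (by norm_num)]
    exact ENNReal.ofReal_le_ofReal (pow_mOuter_le hδ)
  -- Accurate records together with one record of the optimal state force a good output, so the two
  -- failure events cover everything else.
  have hcover : Set.univ ⊆ good ∪ (dev ∪ miss) := by
    intro L _
    by_contra hL
    simp only [Set.mem_union, not_or, hdev, hmiss, Set.mem_ofPred_eq] at hL
    push Not at hL
    refine hL.1 ?_
    exact fidelity_bestRecord_ge hL.2.1 hL.2.2
  have htotal : 1 ≤ D.toOuterMeasure good + ENNReal.ofReal δ := by
    calc (1 : ENNReal) = D.toOuterMeasure Set.univ := (toOuterMeasure_univ D).symm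
      _ ≤ D.toOuterMeasure (good ∪ (dev ∪ miss)) := D.toOuterMeasure.mono hcover
      _ ≤ D.toOuterMeasure good + (D.toOuterMeasure dev + D.toOuterMeasure miss) :=
          (MeasureTheory.measure_union_le _ _).trans
            (add_le_add_right (MeasureTheory.measure_union_le _ _) _)
      _ ≤ D.toOuterMeasure good + (ENNReal.ofReal (δ / 2) + ENNReal.ofReal (δ / 2)) := by gcongr
      _ = _ := by rw [← ENNReal.ofReal_add (by linarith) (by linarith), add_halves]
  rw [ENNReal.ofReal_sub _ hδ.le, ENNReal.ofReal_one]
  exact tsub_le_iff_right.2 htotal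

end StabProdTomography
open StabProdTomography in
theorem mainTheorem1 (n : ℕ) (hn : 1 ≤ n) (ψ : PureState n) (ε τ p δ : ℝ)
    (hε : 0 < ε) (hετ : ε ≤ τ) (hτ : τ < 1) (hp : 1 / 2 < p) (hp1 : p < 1)
    (hδ : 0 < δ) (hδ1 : δ < 1) :
    (τ ≤ stabProdFidelity ψ →
      ENNReal.ofReal (1 - δ) ≤ (stabProdApprox ψ ε τ p δ).toOuterMeasure
        {φ | fidelity φ ψ ≥ stabProdFidelity ψ - ε}) ∧
    ENNReal.ofReal (1 - δ) ≤ (stabProdApprox ψ ε ε p δ).toOuterMeasure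
      {φ | fidelity φ ψ ≥ stabProdFidelity ψ - ε} := by
  refine ⟨le_stabProdApprox_of_le hn ψ hε hετ hτ hp hp1 hδ hδ1, ?_⟩
  -- If the maximal fidelity is below ε, the required bound is negative and every output satisfies
  -- it.
  rcases le_or_gt ε (stabProdFidelity ψ) with hF | hF
  · exact le_stabProdApprox_of_le hn ψ hε le_rfl (hετ.trans_lt hτ) hp hp1 hδ hδ1 hF
  · have huniv : {φ : StabProd n | fidelity φ ψ ≥ stabProdFidelity ψ - ε} = Set.univ := by
      refine Set.eq_univ_of_forall fun φ => ?_
      have := fidelity_nonneg φ ψ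
      simp only [Set.mem_ofPred_eq, ge_iff_le]
      linarith
    rw [huniv, toOuterMeasure_univ]
    exact ENNReal.ofReal_le_one.2 (by linarith)
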